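/- Let $N\in\mathbb N$ and let $\mu$ be a matrix measure on $\mathbb R$, i.e. a $\sigma$-additive map from the Borel sets of $\mathbb R$ to the positive semi-definite matrices in $M_N(\mathbb C)$. Let $\tau_\mu(B)=\operatorname{Tr}\mu(B)$ be its trace measure and $W=d\mu/d\tau_\mu$ its (a.e. positive semi-definite) matrix density, $\mu(B)_{i,j}=\int_B W_{i,j}\,d\tau_\mu$. Assume that $\tau_\mu$ has infinite support, that all functions $x\mapsto x^kW_{i,j}(x)$, $k\ge 0$, are in $L^1(\tau_\mu)$, and that all even moments $M_{2k}=\int_{\mathbb R}x^{2k}W(x)\,d\tau_\mu(x)$ are positive definite ($W(x)$ itself need not be invertible). Let $(P_n)_{n\ge 0}$ be matrix-valued orthonormal polynomials for $\mu$: $P_n$ has degree $n$ with invertible leading coefficient and $$\int_{\mathbb R}P_n(x)W(x)P_m(x)^*\,d\tau_\mu(x)=\delta_{n,m}I .$$ Put $A_n=\int xP_n(x)W(x)P_{n+1}(x)^*\,d\tau_\mu(x)$ and $B_n=\int xP_n(x)W(x)P_n(x)^*\,d\tau_\mu(x)$. Then $\det A_n\neq 0$, $B_n^*=B_n$, and,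 with the last term absent for $n=0$, $$zP_n(z)=A_nP_{n+1}(z)+B_nP_n(z)+A_{n-1}^*P_{n-1}(z)\qquad(n\ge 0,\ z\in\mathbb C).$$ Let $J$ be the Jacobi operator in $\ell^2(\mathbb C^N)$ whose domain $\mathcal D$ consists of the finitely supported sequences, $(JV)_n=A_nv_{n+1}+B_nv_n+A_{n-1}^*v_{n-1}$ (last term absent for $n=0$), and let $(J^*,\mathcal D^*)$ be its adjoint. For $z\in\mathbb C$ let $S_z^+$ be the space of all $(v_n)\in\ell^2(\mathbb C^N)$ with $zv_n=A_nv_{n+1}+B_nv_n+A_{n-1}^*v_{n-1}$ for all sufficiently large $n$. Let $L^2_v(\mu)$ be the Hilbert space of measurable $f:\mathbb R\to\mathbb C^N$ with $\int f^*Wf\,d\tau_\mu<\infty$, modulo those with $\int f^*Wf\,d\tau_\mu=0$, with inner product $\langle f,g\rangle=\int g^*Wf\,d\tau_\mu$, and let $M_z$ be multiplication by the variable on $L^2_v(\mu)$ with its maximal domain. (i) If $(P_n(z)v)_{n\ge0}\notin S_z^+$ for all $z\in\mathbb C\setminus\mathbb R$ and all $v\in\mathbb C^N\setminus\{0\}$,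 then $(J,\mathcal D)$ is essentially self-adjoint. (ii) If $(J,\mathcal D)$ is essentially self-adjoint, then $(J^*,\mathcal D^*)$ is self-adjoint and equals the closure of $(J,\mathcal D)$, and there is a unitary map $$\mathcal U:\ell^2(\mathbb C^N)\to L^2_v(\mu),\qquad \mathcal U\big((v_n)_{n\ge 0}\big)=\sum_{n=0}^\infty P_n(\cdot)^*v_n,$$ (the series converging in $L^2_v(\mu)$) with $\mathcal U J^*=M_z\,\mathcal U$ as an equality of unbounded operators. Moreover $\sigma(J^*)=\operatorname{supp}\tau_\mu$, and the multiplicity of the spectrum of $J^*$ is given $\tau_\mu$-a.e. by the function $d(x)=\dim\operatorname{Ran}W(x)$. That is, $d$ is measurable, $d>0$ $\tau_\mu$-a.e., and $J^*$ is unitarily equivalent to multiplication by $x$, on its maximal domain, on the direct integral $\int^{\oplus}H_{d(x)}\,d\tau_\mu(x)$, where $H_d$ denotes a Hilbert space of dimension $d$. -/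

import Mathlib

open MeasureTheory
open scoped ComplexOrder Matrix

noncomputable section

/-- A matrix-valued measure on `ℝ`: a (countably additive) map from the Borel sets of `ℝ` to the
positive semi-definite complex `N × N` matrices. -/
structure MatrixMeasure (N : ℕ) where
  toVectorMeasure : VectorMeasure ℝ (Matrix (Fin N) (Fin N) ℂ)
  posSemidef : ∀ B : Set ℝ, MeasurableSet B → (toVectorMeasure B).PosSemidef

namespace MatrixMeasure

variable {N : ℕ} (μ : MatrixMeasure N)

/-- The complex measure `B ↦ μ(B)ᵢⱼ`. -/
def entry (i j : Fin N) : ComplexMeasure ℝ :=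
  μ.toVectorMeasure.mapRange (Matrix.entryAddMonoidHom ℂ i j)
    (continuous_id.matrix_elem i j)

/-- The signed measure `B ↦ Tr μ(B)`. -/
def traceSigned : SignedMeasure ℝ :=
  μ.toVectorMeasure.mapRange
    (Complex.reAddGroupHom.comp (Matrix.traceAddMonoidHom (Fin N) ℂ))
    (Complex.continuous_re.comp continuous_id.matrix_trace)

theorem traceSigned_nonneg : VectorMeasure.restrict 0 Set.univ ≤
    VectorMeasure.restrict μ.traceSigned Set.univ := by
  rw [VectorMeasure.restrict_univ, VectorMeasure.restrict_univ]
  intro B hB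
  exact (Complex.nonneg_iff.1 (μ.posSemidef B hB).trace_nonneg).1

/-- The trace measure `τ_μ`, i.e. the positive Borel measure `B ↦ Tr μ(B)`. -/
def trace : Measure ℝ :=
  μ.traceSigned.toMeasureOfZeroLE Set.univ MeasurableSet.univ μ.traceSigned_nonneg

instance : IsFiniteMeasure μ.trace := by
  unfold trace; infer_instance

/-- The density `W = dμ / dτ_μ`, the matrix of the Radon-Nikodym derivatives of the entries of `μ`
with respect to the trace measure. -/
def density (x : ℝ) : Matrix (Fin N) (Fin N) ℂ :=
  Matrix.of fun i j => (μ.entry i j).rnDeriv μ.trace x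

theorem trace_real_apply {B : Set ℝ} (hB : MeasurableSet B) :
    μ.trace.real B = (μ.toVectorMeasure B).trace.re := by
  rw [trace, SignedMeasure.toMeasureOfZeroLE_real_apply _ _ _ hB,
    Set.univ_inter]
  rfl

theorem measurable_density (i j : Fin N) : Measurable fun x => μ.density x i j := by
  have h : (fun x => μ.density x i j) = fun x =>
      ((((μ.entry i j).re.rnDeriv μ.trace x : ℝ) : ℂ) +
        (((μ.entry i j).im.rnDeriv μ.trace x : ℝ) : ℂ) * Complex.I) := by
    funext x
    exact Complex.mk_eq_add_mul_I _ _
  rw [h]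
  exact ((Complex.measurable_ofReal.comp (SignedMeasure.measurable_rnDeriv _ _)).add
    ((Complex.measurable_ofReal.comp (SignedMeasure.measurable_rnDeriv _ _)).mul_const _))

theorem integrable_density (i j : Fin N) :
    Integrable (fun x => μ.density x i j) μ.trace :=
  ComplexMeasure.integrable_rnDeriv _ _

/-- `μ(B)ᵢⱼ = ∫_B Wᵢⱼ dτ_μ`. -/
theorem apply_eq_setIntegral_density {B : Set ℝ} (hB : MeasurableSet B) (i j : Fin N) :
    μ.toVectorMeasure B i j = ∫ x in B, μ.density x i j ∂μ.trace := by
  have key : ∀ C : Set ℝ, μ.trace.toENNRealVectorMeasure C = 0 → μ.entry i j C = 0 := by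
    intro C hC
    by_cases hm : MeasurableSet C
    · rw [Measure.toENNRealVectorMeasure_apply_measurable hm] at hC
      have h1 : (μ.toVectorMeasure C).trace.re = 0 := by
        rw [← μ.trace_real_apply hm, measureReal_def, hC]; rfl
      have h2 := Complex.nonneg_iff.1 (μ.posSemidef C hm).trace_nonneg
      have h3 : (μ.toVectorMeasure C).trace = 0 := Complex.ext h1 h2.2.symm
      have h4 := (μ.posSemidef C hm).trace_eq_zero_iff.1 h3
      change μ.toVectorMeasure C i j = 0
      rw [h4]; rfl
    · exact (μ.entry i j).not_measurable hm
  have hre : (μ.entry i j).re ≪ᵥ μ.trace.toENNRealVectorMeasure := by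
    intro C hC
    change (μ.entry i j C).re = 0
    rw [key C hC]; rfl
  have him : (μ.entry i j).im ≪ᵥ μ.trace.toENNRealVectorMeasure := by
    intro C hC
    change (μ.entry i j C).im = 0
    rw [key C hC]; rfl
  have e1 := SignedMeasure.withDensityᵥ_rnDeriv_eq _ _ hre
  have e2 := SignedMeasure.withDensityᵥ_rnDeriv_eq _ _ him
  have hint : IntegrableOn (fun x => μ.density x i j) B μ.trace :=
    (μ.integrable_density i j).integrableOn
  have hL : μ.toVectorMeasure B i j = μ.entry i j B := rfl
  rw [hL]
  apply Complex.ext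
  · have : (μ.trace.withDensityᵥ ((μ.entry i j).re.rnDeriv μ.trace)) B = (μ.entry i j).re B := by
      rw [e1]
    rw [withDensityᵥ_apply (SignedMeasure.integrable_rnDeriv _ _) hB] at this
    have h2 := integral_re (𝕜 := ℂ) hint
    exact this.symm.trans h2
  · have : (μ.trace.withDensityᵥ ((μ.entry i j).im.rnDeriv μ.trace)) B = (μ.entry i j).im B := by
      rw [e2]
    rw [withDensityᵥ_apply (SignedMeasure.integrable_rnDeriv _ _) hB] at this
    have h2 := integral_im (𝕜 := ℂ) hint
    exact this.symm.trans h2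

theorem integral_quadratic {B : Set ℝ} (hB : MeasurableSet B) (v : Fin N → ℂ) :
    Integrable (fun x => star v ⬝ᵥ (μ.density x *ᵥ v)) μ.trace ∧
    star v ⬝ᵥ (μ.toVectorMeasure B *ᵥ v) =
      ∫ x in B, star v ⬝ᵥ (μ.density x *ᵥ v) ∂μ.trace := by
  have hi : ∀ i j : Fin N,
      Integrable (fun x => star (v i) * (μ.density x i j * v j)) μ.trace := fun i j =>
    ((μ.integrable_density i j).mul_const _).const_mul _
  simp only [dotProduct, Matrix.mulVec, Finset.mul_sum, Pi.star_apply]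
  constructor
  · exact integrable_finsetSum _ fun i _ => integrable_finsetSum _ fun j _ => hi i j
  · rw [integral_finsetSum _ fun i _ =>
      (integrable_finsetSum _ fun j _ => hi i j).integrableOn]
    refine Finset.sum_congr rfl fun i _ => ?_
    rw [integral_finsetSum _ fun j _ => (hi i j).integrableOn]
    refine Finset.sum_congr rfl fun j _ => ?_
    rw [integral_const_mul, integral_mul_const, μ.apply_eq_setIntegral_density hB]

/-- `W(x)` is positive semi-definite for `τ_μ`-almost every `x`. -/
theorem ae_posSemidef_density : ∀ᵐ x ∂μ.trace, (μ.density x).PosSemidef := by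
  have hH : ∀ᵐ x ∂μ.trace, ∀ i j, star (μ.density x j i) = μ.density x i j := by
    rw [ae_all_iff]; intro i
    rw [ae_all_iff]; intro j
    refine Integrable.ae_eq_of_forall_setIntegral_eq (μ := μ.trace)
      (fun x => star (μ.density x j i)) (fun x => μ.density x i j) ?_
      (μ.integrable_density i j) ?_
    · exact (Complex.conjCLE : ℂ →L[ℝ] ℂ).integrable_comp (μ.integrable_density j i)
    · intro B hB _
      have h1 : ∫ x in B, star (μ.density x j i) ∂μ.trace =
          star (∫ x in B, μ.density x j i ∂μ.trace) := integral_conj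
      rw [h1, ← μ.apply_eq_setIntegral_density hB, ← μ.apply_eq_setIntegral_density hB]
      exact (μ.posSemidef B hB).1.apply i j
  have hQ : ∀ᵐ x ∂μ.trace, ∀ n : ℕ,
      0 ≤ (star (TopologicalSpace.denseSeq (Fin N → ℂ) n) ⬝ᵥ
        (μ.density x *ᵥ TopologicalSpace.denseSeq (Fin N → ℂ) n)).re := by
    rw [ae_all_iff]; intro n
    set v := TopologicalSpace.denseSeq (Fin N → ℂ) n
    have hv := (μ.integral_quadratic MeasurableSet.univ v).1
    refine ae_nonneg_of_forall_setIntegral_nonneg (μ := μ.trace) hv.re fun B hB _ => ?_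
    have h2 := integral_re (𝕜 := ℂ) (hv.integrableOn (s := B))
    rw [← (μ.integral_quadratic hB v).2] at h2
    exact h2.symm ▸ (μ.posSemidef B hB).re_dotProduct_nonneg v
  filter_upwards [hH, hQ] with x h1 h2
  have hherm : (μ.density x).IsHermitian := Matrix.IsHermitian.ext fun i j => h1 i j
  refine Matrix.PosSemidef.of_dotProduct_mulVec_nonneg hherm fun v => ?_
  rw [Complex.nonneg_iff]
  constructor
  · have hc : Continuous fun v : Fin N → ℂ => (star v ⬝ᵥ (μ.density x *ᵥ v)).re := by
      fun_prop
    have hcl : IsClosed {v : Fin N → ℂ | 0 ≤ (star v ⬝ᵥ (μ.density x *ᵥ v)).re} :=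
      isClosed_le continuous_const hc
    have hd := (TopologicalSpace.denseRange_denseSeq (Fin N → ℂ)).closure_range
    have : closure (Set.range (TopologicalSpace.denseSeq (Fin N → ℂ))) ⊆
        {v : Fin N → ℂ | 0 ≤ (star v ⬝ᵥ (μ.density x *ᵥ v)).re} :=
      closure_minimal (by rintro _ ⟨n, rfl⟩; exact h2 n) hcl
    exact this (hd ▸ Set.mem_univ v)
  · have := hherm.im_star_dotProduct_mulVec_self (x := v)
    exact this.symm

end MatrixMeasure

namespace MatrixMeasure

variable {N : ℕ} (μ : MatrixMeasure N)

open scoped MatrixOrder Matrix.Norms.L2Operator in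
theorem norm_form_le {W : Matrix (Fin N) (Fin N) ℂ} (hW : W.PosSemidef) (a b : Fin N → ℂ) :
    ‖star a ⬝ᵥ (W *ᵥ b)‖ ≤ ‖star a ⬝ᵥ (W *ᵥ a)‖ + ‖star b ⬝ᵥ (W *ᵥ b)‖ := by
  obtain ⟨C, rfl⟩ := CStarAlgebra.nonneg_iff_eq_star_mul_self.1 hW.nonneg
  have key : ∀ u w : Fin N → ℂ, star u ⬝ᵥ ((star C * C) *ᵥ w) = star (C *ᵥ u) ⬝ᵥ (C *ᵥ w) := by
    intro u w
    rw [← Matrix.mulVec_mulVec, Matrix.dotProduct_mulVec, Matrix.star_mulVec]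
    rfl
  have hn : ∀ u : Fin N → ℂ, ‖star u ⬝ᵥ u‖ = ∑ i, ‖u i‖ ^ 2 := by
    intro u
    have : star u ⬝ᵥ u = ((∑ i, ‖u i‖ ^ 2 : ℝ) : ℂ) := by
      simp [dotProduct, Complex.conj_mul']
    rw [this, Complex.norm_real, Real.norm_of_nonneg (by positivity)]
  rw [key, key, key, hn, hn, ← Finset.sum_add_distrib]
  refine (norm_sum_le _ _).trans (Finset.sum_le_sum fun i _ => ?_)
  rw [norm_mul, Pi.star_apply, norm_star]
  nlinarith [sq_nonneg (‖(C *ᵥ a) i‖ - ‖(C *ᵥ b) i‖), sq_nonneg ‖(C *ᵥ a) i‖,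
    sq_nonneg ‖(C *ᵥ b) i‖]

theorem measurable_form {f g : ℝ → Fin N → ℂ} (hf : Measurable f) (hg : Measurable g) :
    Measurable fun x => star (f x) ⬝ᵥ (μ.density x *ᵥ g x) := by
  simp only [dotProduct, Matrix.mulVec, Pi.star_apply]
  refine Finset.measurable_sum _ fun i _ => Measurable.mul ?_ ?_
  · exact Complex.continuous_conj.measurable.comp (measurable_pi_iff.1 hf i)
  · exact Finset.measurable_sum _ fun j _ =>
      (μ.measurable_density i j).mul (measurable_pi_iff.1 hg j)

/-- `f` is measurable and `∫ f(x)^* W(x) f(x) dτ_μ(x) < ∞` (the integrand is nonnegative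
almost everywhere). -/
def MemL2 (f : ℝ → Fin N → ℂ) : Prop :=
  Measurable f ∧ Integrable (fun x => star (f x) ⬝ᵥ (μ.density x *ᵥ f x)) μ.trace

variable {μ} in
theorem MemL2.integrable_form {f g : ℝ → Fin N → ℂ} (hf : μ.MemL2 f) (hg : μ.MemL2 g) :
    Integrable (fun x => star (f x) ⬝ᵥ (μ.density x *ᵥ g x)) μ.trace := by
  refine Integrable.mono' (hf.2.norm.add hg.2.norm)
    (μ.measurable_form hf.1 hg.1).aestronglyMeasurable ?_
  filter_upwards [μ.ae_posSemidef_density] with x hx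
  exact norm_form_le hx _ _

/-- The space of measurable functions `f : ℝ → ℂ^N` with `∫ f^* W f dτ_μ < ∞`. -/
def l2Submodule : Submodule ℂ (ℝ → Fin N → ℂ) where
  carrier := {f | μ.MemL2 f}
  zero_mem' := ⟨measurable_const, by simp⟩
  add_mem' := by
    intro f g hf hg
    refine ⟨hf.1.add hg.1, ?_⟩
    have := ((hf.2.add (hf.integrable_form hg)).add (hg.integrable_form hf)).add hg.2
    refine this.congr (Filter.Eventually.of_forall fun x => ?_)
    simp [Matrix.mulVec_add, dotProduct_add, add_dotProduct]
    ring
  smul_mem' := by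
    intro c f hf
    refine ⟨hf.1.const_smul c, ?_⟩
    refine (hf.2.const_mul (star c * c)).congr (Filter.Eventually.of_forall fun x => ?_)
    simp [Matrix.mulVec_smul]
    ring

/-- The pre-Hilbert space `𝓛²_v(μ)` of functions, before passing to equivalence classes. It is a
type synonym, so that it carries the topology of its seminorm only. -/
def PreL2 : Type := μ.l2Submodule

instance : AddCommGroup μ.PreL2 := inferInstanceAs (AddCommGroup μ.l2Submodule)

instance : Module ℂ μ.PreL2 := inferInstanceAs (Module ℂ μ.l2Submodule)

variable {μ} in
/-- The underlying function of an element of `𝓛²_v(μ)`. -/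
def PreL2.fn (f : μ.PreL2) : ℝ → Fin N → ℂ := Subtype.val (p := fun f => f ∈ μ.l2Submodule) f

variable {μ} in
theorem PreL2.mem (f : μ.PreL2) : μ.MemL2 f.fn := f.2

/-- The inner product `⟪f, g⟫ = ∫ f^* W g dτ_μ`, conjugate linear in the first variable. -/
@[reducible]
def preL2Core : PreInnerProductSpace.Core ℂ μ.PreL2 where
  inner f g := ∫ x, star (f.fn x) ⬝ᵥ (μ.density x *ᵥ g.fn x) ∂μ.trace
  conj_inner_symm f g := by
    rw [← integral_conj]
    refine integral_congr_ae ?_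
    filter_upwards [μ.ae_posSemidef_density] with x hx
    change star (star (g.fn x) ⬝ᵥ (μ.density x *ᵥ f.fn x)) = _
    rw [Matrix.star_dotProduct (f.fn x), Matrix.star_mulVec, hx.1.eq, ← Matrix.dotProduct_mulVec]
  re_inner_nonneg f := by
    have h := integral_re (𝕜 := ℂ) f.mem.2
    refine le_of_le_of_eq (integral_nonneg_of_ae ?_) h
    filter_upwards [μ.ae_posSemidef_density] with x hx
    exact hx.re_dotProduct_nonneg _
  add_left f g h := by
    rw [← integral_add (f.mem.integrable_form h.mem) (g.mem.integrable_form h.mem)]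
    refine integral_congr_ae (Filter.Eventually.of_forall fun x => ?_)
    change star (f.fn x + g.fn x) ⬝ᵥ _ = _
    rw [star_add, add_dotProduct]
  smul_left f g c := by
    rw [← integral_const_mul]
    refine integral_congr_ae (Filter.Eventually.of_forall fun x => ?_)
    change star (c • f.fn x) ⬝ᵥ _ = _
    rw [star_smul, smul_dotProduct]
    rfl

instance : SeminormedAddCommGroup μ.PreL2 :=
  @InnerProductSpace.Core.toSeminormedAddCommGroup ℂ μ.PreL2 _ _ _ μ.preL2Core

instance : InnerProductSpace ℂ μ.PreL2 := InnerProductSpace.ofCore μ.preL2Core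

/-- The Hilbert space `L²_v(μ)`: functions `f : ℝ → ℂ^N` with `∫ f^* W f dτ_μ < ∞`, modulo those
with `∫ f^* W f dτ_μ = 0`. (This quotient is complete, so it is its own completion.) -/
abbrev L2 : Type := SeparationQuotient μ.PreL2

/-- The class in `L²_v(μ)` of a square integrable function. -/
def toL2 (f : ℝ → Fin N → ℂ) (hf : μ.MemL2 f) : μ.L2 :=
  SeparationQuotient.mk (⟨f, hf⟩ : μ.l2Submodule)


/-- The graph of multiplication by `x` on `L²_v(μ)`: all pairs `([f], [x f])` for which both `f`
and `x ↦ x f(x)` are square integrable. -/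
def mulGraph : Submodule ℂ (μ.L2 × μ.L2) where
  carrier := {p | ∃ f g : μ.PreL2, (∀ x : ℝ, g.fn x = (x : ℂ) • f.fn x) ∧
    SeparationQuotient.mk f = p.1 ∧ SeparationQuotient.mk g = p.2}
  zero_mem' := ⟨0, 0, fun x => (smul_zero (x : ℂ)).symm, rfl, rfl⟩
  add_mem' := by
    rintro p q ⟨f, g, h, h1, h2⟩ ⟨f', g', h', h1', h2'⟩
    refine ⟨f + f', g + g', fun x => ?_, ?_, ?_⟩
    · change g.fn x + g'.fn x = (x : ℂ) • (f.fn x + f'.fn x)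
      rw [h, h', smul_add]
    · rw [Prod.fst_add, ← h1, ← h1']; rfl
    · rw [Prod.snd_add, ← h2, ← h2']; rfl
  smul_mem' := by
    rintro c p ⟨f, g, h, h1, h2⟩
    refine ⟨c • f, c • g, fun x => ?_, ?_, ?_⟩
    · change c • g.fn x = (x : ℂ) • (c • f.fn x)
      rw [h, smul_comm]
    · rw [Prod.smul_fst, ← h1]; rfl
    · rw [Prod.smul_snd, ← h2]; rfl

theorem PreL2.mk_eq_zero_iff (f : μ.PreL2) : (SeparationQuotient.mk f : μ.L2) = 0 ↔
    ∀ᵐ x ∂μ.trace, star (f.fn x) ⬝ᵥ (μ.density x *ᵥ f.fn x) = 0 := by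
  have h0 : (SeparationQuotient.mk f : μ.L2) = 0 ↔ ‖f‖ = 0 := by
    rw [← SeparationQuotient.norm_mk, norm_eq_zero]
  have h1 : ‖f‖ ^ 2 = ∫ x, (star (f.fn x) ⬝ᵥ (μ.density x *ᵥ f.fn x)).re ∂μ.trace := by
    rw [← inner_self_eq_norm_sq (𝕜 := ℂ)]
    exact (integral_re (𝕜 := ℂ) f.mem.2).symm
  have h2 := integral_eq_zero_iff_of_nonneg_ae (μ := μ.trace)
    (f := fun x => (star (f.fn x) ⬝ᵥ (μ.density x *ᵥ f.fn x)).re) ?_ f.mem.2.re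
  · rw [h0, ← sq_eq_zero_iff, h1, h2]
    refine Filter.eventually_congr ?_
    filter_upwards [μ.ae_posSemidef_density] with x hx
    have := hx.1.im_star_dotProduct_mulVec_self (x := f.fn x)
    exact ⟨fun h => Complex.ext h this, fun h => by rw [h]; rfl⟩
  · filter_upwards [μ.ae_posSemidef_density] with x hx
    exact hx.re_dotProduct_nonneg _

theorem mulGraph_functional (p : μ.L2 × μ.L2) (hp : p ∈ μ.mulGraph) (h0 : p.1 = 0) : p.2 = 0 := by
  obtain ⟨f, g, h, h1, h2⟩ := hp
  rw [← h2, PreL2.mk_eq_zero_iff]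
  rw [← h1, PreL2.mk_eq_zero_iff] at h0
  filter_upwards [h0] with x hx
  rw [h, star_smul, smul_dotProduct, Matrix.mulVec_smul, dotProduct_smul, hx, smul_zero, smul_zero]

/-- The operator `M_z` of multiplication by the variable on `L²_v(μ)`, on its maximal domain. -/
def mulOp : μ.L2 →ₗ.[ℂ] μ.L2 := μ.mulGraph.toLinearPMap

theorem mulOp_graph : μ.mulOp.graph = μ.mulGraph :=
  μ.mulGraph.toLinearPMap_graph_eq μ.mulGraph_functional

/-- The entrywise integral `∫ F(x) dτ_μ(x)` of a matrix-valued function. -/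
def matrixIntegral (F : ℝ → Matrix (Fin N) (Fin N) ℂ) : Matrix (Fin N) (Fin N) ℂ :=
  Matrix.of fun i j => ∫ x, F x i j ∂μ.trace

/-- The moment `M_k = ∫ x^k W(x) dτ_μ(x)`. -/
def moment (k : ℕ) : Matrix (Fin N) (Fin N) ℂ :=
  μ.matrixIntegral fun x => (x : ℂ) ^ k • μ.density x

/-- The trace measure has infinite support, all moments exist, and the even moments are positive
definite. -/
structure HasPosDefEvenMoments : Prop where
  infinite_support : μ.trace.support.Infinite
  integrable : ∀ (k : ℕ) (i j : Fin N),
    Integrable (fun x : ℝ => (x : ℂ) ^ k * μ.density x i j) μ.trace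
  posDef : ∀ k : ℕ, (μ.moment (2 * k)).PosDef

/-- The value `∑ z^k C_k` at `z ∈ ℂ` of the matrix polynomial `∑ C_k X^k`. -/
def evalAt (Q : Polynomial (Matrix (Fin N) (Fin N) ℂ)) (z : ℂ) : Matrix (Fin N) (Fin N) ℂ :=
  Q.eval (Matrix.scalar (Fin N) z)

theorem evalAt_eq_sum (Q : Polynomial (Matrix (Fin N) (Fin N) ℂ)) (z : ℂ) :
    evalAt Q z = ∑ k ∈ Q.support, z ^ k • Q.coeff k := by
  rw [evalAt, Polynomial.eval_eq_sum, Polynomial.sum]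
  refine Finset.sum_congr rfl fun k _ => ?_
  rw [← map_pow, ← Matrix.scalar_commute (z ^ k) (fun r => mul_comm _ r) (Q.coeff k)]
  simp [Matrix.scalar_apply, ← Matrix.smul_eq_diagonal_mul]

variable {μ} in
theorem HasPosDefEvenMoments.memL2 (hμ : μ.HasPosDefEvenMoments)
    (Q : Polynomial (Matrix (Fin N) (Fin N) ℂ)) (v : Fin N → ℂ) :
    μ.MemL2 fun x => (evalAt Q x)ᴴ *ᵥ v := by
  have h1 : ∀ (k : ℕ) (c : Fin N → ℂ), (fun x : ℝ => (x : ℂ) ^ k • c) ∈ μ.l2Submodule := by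
    intro k c
    constructor
    · exact ((Complex.measurable_ofReal).pow_const k).smul_const c
    · have : Integrable (fun x : ℝ => ∑ i, ∑ j,
          (star (c i) * c j) * ((x : ℂ) ^ (2 * k) * μ.density x i j)) μ.trace :=
        integrable_finsetSum _ fun i _ => integrable_finsetSum _ fun j _ =>
          (hμ.integrable (2 * k) i j).const_mul _
      refine this.congr (Filter.Eventually.of_forall fun x => ?_)
      simp only [dotProduct, Matrix.mulVec, Finset.mul_sum, Pi.star_apply, Pi.smul_apply,
        smul_eq_mul, star_mul', star_pow]
      refine Finset.sum_congr rfl fun i _ => Finset.sum_congr rfl fun j _ => ?_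
      have : star (x : ℂ) = x := Complex.conj_ofReal x
      rw [this]; ring
  have h2 : (fun x : ℝ => (evalAt Q x)ᴴ *ᵥ v) =
      ∑ k ∈ Q.support, fun x : ℝ => (x : ℂ) ^ k • ((Q.coeff k)ᴴ *ᵥ v) := by
    funext x
    rw [evalAt_eq_sum, Finset.sum_apply, Matrix.conjTranspose_sum, Matrix.sum_mulVec]
    refine Finset.sum_congr rfl fun k _ => ?_
    rw [Matrix.conjTranspose_smul, Matrix.smul_mulVec, star_pow]
    have : star (x : ℂ) = x := Complex.conj_ofReal x
    rw [this]
  have h3 := μ.l2Submodule.sum_mem (t := Q.support) fun k _ => h1 k ((Q.coeff k)ᴴ *ᵥ v)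
  rw [← h2] at h3
  exact h3

/-- `P 0, P 1, …` are orthonormal matrix polynomials: `P n` has degree `n` with invertible leading
coefficient and `∫ P_n W P_m^* dτ_μ = δ_{n,m} I`. -/
structure IsOrthonormalPolys (P : ℕ → Polynomial (Matrix (Fin N) (Fin N) ℂ)) : Prop where
  natDegree_le : ∀ n, (P n).natDegree ≤ n
  isUnit_coeff : ∀ n, IsUnit ((P n).coeff n)
  orthonormal : ∀ n m,
    μ.matrixIntegral (fun x => evalAt (P n) x * μ.density x * (evalAt (P m) x)ᴴ) =
      if n = m then 1 else 0

/-- The recurrence coefficient `A_n = ∫ x P_n W P_{n+1}^* dτ_μ`. -/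
def jacobiA (P : ℕ → Polynomial (Matrix (Fin N) (Fin N) ℂ)) (n : ℕ) :
    Matrix (Fin N) (Fin N) ℂ :=
  μ.matrixIntegral fun x => (x : ℂ) • (evalAt (P n) x * μ.density x * (evalAt (P (n + 1)) x)ᴴ)

/-- The recurrence coefficient `B_n = ∫ x P_n W P_n^* dτ_μ`. -/
def jacobiB (P : ℕ → Polynomial (Matrix (Fin N) (Fin N) ℂ)) (n : ℕ) :
    Matrix (Fin N) (Fin N) ℂ :=
  μ.matrixIntegral fun x => (x : ℂ) • (evalAt (P n) x * μ.density x * (evalAt (P n) x)ᴴ)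

end MatrixMeasure

/-- The Hilbert space `ℓ²(ℂ^N)` of square summable sequences in `ℂ^N`. -/
abbrev Ell2 (N : ℕ) : Type := lp (fun _ : ℕ => EuclideanSpace ℂ (Fin N)) 2

section Jacobi

variable {N : ℕ} (A B : ℕ → Matrix (Fin N) (Fin N) ℂ)

/-- The formal action of the block Jacobi matrix on sequences:
`A_n v_{n+1} + B_n v_n + A_{n-1}^* v_{n-1}` in position `n`, the last term being absent for
`n = 0`. -/
def jacobiAction (v : ℕ → EuclideanSpace ℂ (Fin N)) : ℕ → EuclideanSpace ℂ (Fin N)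
  | 0 => Matrix.toLpLin 2 2 (A 0) (v 1) + Matrix.toLpLin 2 2 (B 0) (v 0)
  | n + 1 => Matrix.toLpLin 2 2 (A (n + 1)) (v (n + 2)) +
      Matrix.toLpLin 2 2 (B (n + 1)) (v (n + 1)) + Matrix.toLpLin 2 2 (A n)ᴴ (v n)

/-- The subspace `𝓓` of finitely supported sequences. -/
def finiteSequences (N : ℕ) : Submodule ℂ (Ell2 N) where
  carrier := {V | {n | V n ≠ 0}.Finite}
  zero_mem' := by simp
  add_mem' := by
    intro V V' h h'
    refine (h.union h').subset fun n hn => ?_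
    by_contra hc
    simp only [Set.mem_union, Set.mem_ofPred_eq, not_or, not_not] at hc
    exact hn (by simp [hc.1, hc.2])
  smul_mem' := by
    intro c V h
    refine h.subset fun n hn hc => hn ?_
    simp [hc]

theorem memℓp_jacobiAction {V : ℕ → EuclideanSpace ℂ (Fin N)} (hV : {n | V n ≠ 0}.Finite) :
    Memℓp (jacobiAction A B V) 2 := by
  obtain ⟨K, hK⟩ := hV.bddAbove
  have h0 : ∀ n, K < n → V n = 0 := fun n hn => by
    by_contra hc
    exact absurd (hK hc) (not_le.2 hn)
  refine (memℓp_zero ((Set.finite_Iic (K + 1)).subset fun n hn => ?_)).of_exponent_ge (zero_le)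
  by_contra hc
  simp only [Set.mem_Iic, not_le] at hc
  refine hn ?_
  cases n with
  | zero => omega
  | succ n => simp [jacobiAction, h0 n (by omega), h0 (n + 1) (by omega), h0 (n + 2) (by omega)]

/-- The Jacobi operator `(J, 𝓓)` in `ℓ²(ℂ^N)`. -/
def jacobiOp : Ell2 N →ₗ.[ℂ] Ell2 N where
  domain := finiteSequences N
  toFun :=
    { toFun := fun V => ⟨jacobiAction A B V.1, memℓp_jacobiAction A B V.2⟩
      map_add' := by
        intro V V'
        ext1
        funext n
        change jacobiAction A B (fun k => V.1 k + V'.1 k) n =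
          jacobiAction A B V.1 n + jacobiAction A B V'.1 n
        cases n <;> simp only [jacobiAction, map_add] <;> abel
      map_smul' := by
        intro c V
        ext1
        funext n
        change jacobiAction A B (fun k => c • V.1 k) n = c • jacobiAction A B V.1 n
        cases n <;> simp only [jacobiAction, map_smul, smul_add] }

/-- The space `S_z^+` of square summable sequences that satisfy
`z v_n = A_n v_{n+1} + B_n v_n + A_{n-1}^* v_{n-1}` for all sufficiently large `n`. -/
def freeSolutions (z : ℂ) : Set (ℕ → EuclideanSpace ℂ (Fin N)) :=
  {v | Memℓp v 2 ∧ ∃ M : ℕ, ∀ n ≥ M, z • v n = jacobiAction A B v n}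

end Jacobi

section Unbounded

variable {H K : Type} [NormedAddCommGroup H] [InnerProductSpace ℂ H]
  [NormedAddCommGroup K] [InnerProductSpace ℂ K]

/-- A densely defined closable operator is essentially self-adjoint if its closure is
self-adjoint. -/
def IsEssentiallySelfAdjoint [CompleteSpace H] (T : H →ₗ.[ℂ] H) : Prop :=
  Dense (T.domain : Set H) ∧ T.IsClosable ∧ IsSelfAdjoint T.closure

/-- The spectrum of an unbounded operator: the complement of the set of all `z` for which
`T - z : 𝓓(T) → H` is bijective with a bounded inverse `R`. -/
def unboundedSpectrum (T : H →ₗ.[ℂ] H) : Set ℂ :=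
  {z | ¬ ∃ R : H →L[ℂ] H, (∀ h, (R h, h + z • R h) ∈ T.graph) ∧
    ∀ x : T.domain, R (T x - z • (x : H)) = x}

/-- The equality `U T = S U` of unbounded operators, for a unitary `U`: the domain of `S` is the
image of the domain of `T`, and `S (U x) = U (T x)` there. -/
def Intertwines (U : H ≃ₗᵢ[ℂ] K) (T : H →ₗ.[ℂ] H) (S : K →ₗ.[ℂ] K) : Prop :=
  ∀ x y : H, (x, y) ∈ T.graph ↔ (U x, U y) ∈ S.graph

/-- The direct integral `∫ H_{m(x)} dν(x)`, where `H_d` is the `d`-dimensional space of all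
sequences in `ℓ²(ℕ)` supported on `{0, …, d - 1}`: the square integrable `g` with
`g(x) ∈ H_{m(x)}` for almost every `x`. -/
def directIntegral (ν : Measure ℝ) (m : ℝ → ℕ) :
    Submodule ℂ (Lp (lp (fun _ : ℕ => ℂ) 2) 2 ν) where
  carrier := {g | ∀ᵐ x ∂ν, ∀ k, m x ≤ k → g x k = 0}
  zero_mem' := by
    change ∀ᵐ x ∂ν, ∀ k, m x ≤ k → (0 : Lp (lp (fun _ : ℕ => ℂ) 2) 2 ν) x k = 0
    filter_upwards [Lp.coeFn_zero (lp (fun _ : ℕ => ℂ) 2) 2 ν] with x hx k _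
    rw [hx]; rfl
  add_mem' := by
    intro f g hf hg
    change ∀ᵐ x ∂ν, ∀ k, m x ≤ k → (f + g) x k = 0
    filter_upwards [hf, hg, Lp.coeFn_add f g] with x h1 h2 h3 k hk
    rw [h3]
    simp [h1 k hk, h2 k hk]
  smul_mem' := by
    intro c f hf
    change ∀ᵐ x ∂ν, ∀ k, m x ≤ k → (c • f) x k = 0
    filter_upwards [hf, Lp.coeFn_smul c f] with x h1 h3 k hk
    rw [h3]
    simp [h1 k hk]

/-- The graph of multiplication by `x` on the direct integral. -/
def directIntegralMulGraph (ν : Measure ℝ) (m : ℝ → ℕ) :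
    Submodule ℂ (directIntegral ν m × directIntegral ν m) where
  carrier := {p | ∀ᵐ x ∂ν, p.2.1 x = (x : ℂ) • p.1.1 x}
  zero_mem' := by
    change ∀ᵐ x ∂ν, (0 : Lp (lp (fun _ : ℕ => ℂ) 2) 2 ν) x =
      (x : ℂ) • (0 : Lp (lp (fun _ : ℕ => ℂ) 2) 2 ν) x
    filter_upwards [Lp.coeFn_zero (lp (fun _ : ℕ => ℂ) 2) 2 ν] with x hx
    rw [hx]; exact (smul_zero _).symm
  add_mem' := by
    intro p q hp hq
    change ∀ᵐ x ∂ν, (p.2.1 + q.2.1) x = (x : ℂ) • (p.1.1 + q.1.1) x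
    filter_upwards [hp, hq, Lp.coeFn_add p.1.1 q.1.1, Lp.coeFn_add p.2.1 q.2.1] with x h1 h2 h3 h4
    rw [h3, h4, Pi.add_apply, Pi.add_apply, h1, h2, smul_add]
  smul_mem' := by
    intro c p hp
    change ∀ᵐ x ∂ν, (c • p.2.1) x = (x : ℂ) • (c • p.1.1) x
    filter_upwards [hp, Lp.coeFn_smul c p.1.1, Lp.coeFn_smul c p.2.1] with x h1 h3 h4
    rw [h3, h4, Pi.smul_apply, Pi.smul_apply, h1, smul_comm]

/-- The operator of multiplication by `x` on the direct integral, on its maximal domain. -/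
def directIntegralMulOp (ν : Measure ℝ) (m : ℝ → ℕ) :
    directIntegral ν m →ₗ.[ℂ] directIntegral ν m :=
  (directIntegralMulGraph ν m).toLinearPMap

theorem directIntegralMulOp_graph (ν : Measure ℝ) (m : ℝ → ℕ) :
    (directIntegralMulOp ν m).graph = directIntegralMulGraph ν m := by
  refine Submodule.toLinearPMap_graph_eq _ fun p hp h0 => ?_
  have h1 : ∀ᵐ x ∂ν, p.2.1 x = (x : ℂ) • p.1.1 x := hp
  apply Subtype.ext
  refine Lp.ext ?_
  rw [h0] at h1
  filter_upwards [h1, Lp.coeFn_zero (lp (fun _ : ℕ => ℂ) 2) 2 ν] with x h2 h3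
  rw [h2]
  change (x : ℂ) • (0 : Lp (lp (fun _ : ℕ => ℂ) 2) 2 ν) x =
    (0 : Lp (lp (fun _ : ℕ => ℂ) 2) 2 ν) x
  rw [h3]; exact smul_zero _

/-- `m` is the multiplicity function of the operator `T` with respect to the measure `ν`: it is
measurable, `ν`-almost everywhere nonzero, and `T` is unitarily equivalent to multiplication by `x`
on the direct integral `∫ H_{m(x)} dν(x)`, where `dim H_d = d`. -/
def IsMultiplicityFunction (T : H →ₗ.[ℂ] H) (ν : Measure ℝ) [SigmaFinite ν] (m : ℝ → ℕ) : Prop :=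
  Measurable m ∧ (∀ᵐ x ∂ν, 0 < m x) ∧
    ∃ U : H ≃ₗᵢ[ℂ] directIntegral ν m, Intertwines U T (directIntegralMulOp ν m)

end Unbounded

end

/-!
The orthonormal polynomials define an isometry `U (v_n) = ∑ P_n^* v_n` from `ℓ²(ℂ^N)` into
`L²_v(μ)`, and the three-term recurrence says that `U J ⊆ M_z U` (`spectralIsometry_mem_mulGraph`,
a summation by parts). The recurrence itself holds since matrix polynomials of degree at most `n`
are left linear combinations of `P_0, …, P_n` (`expansion`); comparing leading coefficients shows
that `A_n` is invertible.

*Essential self-adjointness.* `J` is symmetric because `M_z` is. By Green's formula its adjoint acts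
by the Jacobi matrix, so an eigenvector of `J^*` for `z` solves the recurrence, hence has the form
`(P_n(z) w)`. If no such sequence is square summable for non-real `z`, the deficiency spaces at `±i`
vanish and `J` is essentially self-adjoint (`LinearPMap.isEssentiallySelfAdjoint_of_adjoint`).

*Surjectivity of `U`.* If `J` is essentially self-adjoint, `J - z` has dense range for non-real `z`,
and `(x - z)⁻¹ U (J - z) V = U V`. So the closed subspace `Ran U` is invariant under the resolvents
of `M_z`. The bounded continuous functions which preserve `Ran U` therefore form a star algebra that
separates the points of `ℝ`. As `Ran U` contains the constants, an `f` orthogonal to `Ran U`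
satisfies `∫ a f^* W e_j dτ_μ = 0` for all `a` in that algebra, and such an algebra determines
finite measures; so `f^* W = 0` almost everywhere (`eq_top_of_resolvent_invariant`). The equality
`U J^* = M_z U` follows since `M_z` is closed and symmetric.

*Multiplicity.* The Gram–Schmidt procedure for the forms `a^* W(x) b`, which drops null vectors and
keeps the others in consecutive positions, is measurable in `x` and yields exactly `rank W(x)`
vectors (`exists_measurable_isFormBasis`, `IsFormBasis.rank_eq`). The coordinates of `f(x)` in this
basis identify `L²_v(μ)` with the direct integral of the spaces `H_{rank W(x)}`, and
multiplication by `x` with multiplication by `x`. This also shows that `L²_v(μ)` is complete.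

*Spectrum.* The function `(x - z)⁻¹` is essentially bounded when `z` is not in the support of
`τ_μ`, and functions concentrated near a point of the support are approximate eigenvectors.
-/

/-! ### The space `L²_v(μ)` and multiplication operators on it -/

noncomputable section

namespace MatrixMeasure

variable {N : ℕ} (μ : MatrixMeasure N)

variable {μ} in
@[simp]
theorem PreL2.fn_add (f g : μ.PreL2) : (f + g).fn = f.fn + g.fn := rfl

variable {μ} in
@[simp]
theorem PreL2.fn_smul (c : ℂ) (f : μ.PreL2) : (c • f).fn = c • f.fn := rfl

theorem inner_mk (f g : μ.PreL2) :
    inner ℂ (SeparationQuotient.mk f : μ.L2) (SeparationQuotient.mk g) =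
      ∫ x, star (f.fn x) ⬝ᵥ (μ.density x *ᵥ g.fn x) ∂μ.trace := rfl

theorem norm_sq_mk (f : μ.PreL2) : ‖(SeparationQuotient.mk f : μ.L2)‖ ^ 2 =
    ∫ x, (star (f.fn x) ⬝ᵥ (μ.density x *ᵥ f.fn x)).re ∂μ.trace := by
  rw [← inner_self_eq_norm_sq (𝕜 := ℂ), inner_mk]
  exact (integral_re (𝕜 := ℂ) f.mem.2).symm

/-- As `W(x)` is semi-definite, the classes of `f` and `g` agree if and only if `W f = W g` almost
everywhere; the functions themselves may differ by elements of the kernel of `W(x)`. -/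
theorem mk_eq_mk_iff (f g : μ.PreL2) :
    (SeparationQuotient.mk f : μ.L2) = SeparationQuotient.mk g ↔
      ∀ᵐ x ∂μ.trace, μ.density x *ᵥ f.fn x = μ.density x *ᵥ g.fn x := by
  rw [← sub_eq_zero]
  change (SeparationQuotient.mk (f - g) : μ.L2) = 0 ↔ _
  rw [PreL2.mk_eq_zero_iff]
  refine Filter.eventually_congr ?_
  filter_upwards [μ.ae_posSemidef_density] with x hx
  rw [hx.dotProduct_mulVec_zero_iff]
  change μ.density x *ᵥ (f.fn x - g.fn x) = 0 ↔ _
  rw [Matrix.mulVec_sub, sub_eq_zero]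

theorem mk_eq_mk_of_ae {f g : μ.PreL2} (h : ∀ᵐ x ∂μ.trace, f.fn x = g.fn x) :
    (SeparationQuotient.mk f : μ.L2) = SeparationQuotient.mk g := by
  rw [mk_eq_mk_iff]
  filter_upwards [h] with x hx
  rw [hx]

variable {μ} in
theorem MemL2.congr_ae {f g : ℝ → Fin N → ℂ} (hf : μ.MemL2 f) (hg : Measurable g)
    (h : ∀ᵐ x ∂μ.trace, f x = g x) : μ.MemL2 g :=
  ⟨hg, hf.2.congr (h.mono fun x hx => by simp only [hx])⟩

theorem form_smul (φ : ℂ) (W : Matrix (Fin N) (Fin N) ℂ) (a : Fin N → ℂ) :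
    star (φ • a) ⬝ᵥ (W *ᵥ (φ • a)) = ((‖φ‖ ^ 2 : ℝ) : ℂ) * (star a ⬝ᵥ (W *ᵥ a)) := by
  rw [star_smul, smul_dotProduct, Matrix.mulVec_smul, dotProduct_smul, smul_smul, smul_eq_mul,
    Complex.star_def, Complex.conj_mul']
  push_cast
  rfl

variable {μ} in
theorem MemL2.bdd_smul {f : ℝ → Fin N → ℂ} (hf : μ.MemL2 f) {φ : ℝ → ℂ} (hφ : Measurable φ)
    {C : ℝ} (hC : ∀ x, ‖φ x‖ ≤ C) : μ.MemL2 fun x => φ x • f x := by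
  refine ⟨hφ.smul hf.1, ?_⟩
  simp only [form_smul]
  refine hf.2.bdd_mul (c := C ^ 2) ?_ (Filter.Eventually.of_forall fun x => ?_)
  · exact (Complex.measurable_ofReal.comp (hφ.norm.pow_const 2)).aestronglyMeasurable
  · rw [Complex.norm_real, norm_pow, norm_norm]
    exact pow_le_pow_left₀ (norm_nonneg _) (hC x) 2

variable {μ} in
/-- The element of `𝓛²_v(μ)` given by a square integrable function. -/
def MemL2.toPre {f : ℝ → Fin N → ℂ} (hf : μ.MemL2 f) : μ.PreL2 := (⟨f, hf⟩ : μ.l2Submodule)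

variable {μ} in
@[simp]
theorem MemL2.fn_toPre {f : ℝ → Fin N → ℂ} (hf : μ.MemL2 f) : hf.toPre.fn = f := rfl

theorem norm_bdd_smul_le {φ : ℝ → ℂ} (hφ : Measurable φ) {C : ℝ} (hC : ∀ x, ‖φ x‖ ≤ C)
    (f : μ.PreL2) : ‖(SeparationQuotient.mk (f.mem.bdd_smul hφ hC).toPre : μ.L2)‖ ≤
      C * ‖(SeparationQuotient.mk f : μ.L2)‖ := by
  have hC0 : 0 ≤ C := (norm_nonneg _).trans (hC 0)
  refine (sq_le_sq₀ (norm_nonneg _) (by positivity)).1 ?_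
  rw [mul_pow, norm_sq_mk, norm_sq_mk, ← integral_const_mul]
  refine integral_mono_ae (f.mem.bdd_smul hφ hC).2.re (f.mem.2.re.const_mul _) ?_
  filter_upwards [μ.ae_posSemidef_density] with x hx
  change (star (φ x • f.fn x) ⬝ᵥ (μ.density x *ᵥ (φ x • f.fn x))).re ≤ _
  rw [form_smul, Complex.re_ofReal_mul]
  exact mul_le_mul_of_nonneg_right (pow_le_pow_left₀ (norm_nonneg _) (hC x) 2)
    (hx.re_dotProduct_nonneg _)

/-- Multiplication by a bounded measurable function, as a bounded operator on `L²_v(μ)`. -/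
def bddMul (φ : ℝ → ℂ) (hφ : Measurable φ) (C : ℝ) (hC : ∀ x, ‖φ x‖ ≤ C) : μ.L2 →L[ℂ] μ.L2 :=
  let T : μ.PreL2 →ₗ[ℂ] μ.L2 :=
    { toFun := fun f => SeparationQuotient.mk (f.mem.bdd_smul hφ hC).toPre
      map_add' := fun f g => congrArg SeparationQuotient.mk
        (Subtype.ext (funext fun x => smul_add (φ x) (f.fn x) (g.fn x)))
      map_smul' := fun c f => congrArg SeparationQuotient.mk
        (Subtype.ext (funext fun x => smul_comm (φ x) c (f.fn x))) }
  SeparationQuotient.liftCLM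
    (T.mkContinuous C fun f => (μ.norm_bdd_smul_le hφ hC f).trans_eq
      (congrArg (C * ·) (SeparationQuotient.norm_mk f)))
    (fun f g h => by
      have h1 := SeparationQuotient.mk_eq_mk.2 h
      rw [mk_eq_mk_iff] at h1
      change (SeparationQuotient.mk (f.mem.bdd_smul hφ hC).toPre : μ.L2) =
        SeparationQuotient.mk (g.mem.bdd_smul hφ hC).toPre
      rw [mk_eq_mk_iff]
      filter_upwards [h1] with x hx
      simp only [MemL2.fn_toPre, Matrix.mulVec_smul, hx])

theorem exists_bddMul_mk (φ : ℝ → ℂ) (hφ : Measurable φ) (C : ℝ) (hC : ∀ x, ‖φ x‖ ≤ C)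
    (f : μ.PreL2) : ∃ r : μ.PreL2, r.fn = (fun x => φ x • f.fn x) ∧
      μ.bddMul φ hφ C hC (SeparationQuotient.mk f) = SeparationQuotient.mk r :=
  ⟨(f.mem.bdd_smul hφ hC).toPre, rfl, rfl⟩

theorem mem_mulGraph {p : μ.L2 × μ.L2} : p ∈ μ.mulGraph ↔
    ∃ f g : μ.PreL2, (∀ x : ℝ, g.fn x = (x : ℂ) • f.fn x) ∧
      SeparationQuotient.mk f = p.1 ∧ SeparationQuotient.mk g = p.2 := Iff.rfl

theorem norm_bddMul_le (φ : ℝ → ℂ) (hφ : Measurable φ) (C : ℝ) (hC : ∀ x, ‖φ x‖ ≤ C)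
    (h : μ.L2) : ‖μ.bddMul φ hφ C hC h‖ ≤ C * ‖h‖ := by
  obtain ⟨f, rfl⟩ := SeparationQuotient.surjective_mk h
  exact μ.norm_bdd_smul_le hφ hC f

/-- The function `x ↦ (x - z)⁻¹`, cut off at distance `δ` from the pole. -/
def truncResolvent (z : ℂ) (δ : ℝ) (x : ℝ) : ℂ :=
  if ‖(x : ℂ) - z‖ < δ then 0 else ((x : ℂ) - z)⁻¹

theorem measurable_truncResolvent (z : ℂ) (δ : ℝ) : Measurable (truncResolvent z δ) := by
  have h : Measurable fun x : ℝ => (x : ℂ) - z := Complex.measurable_ofReal.sub_const z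
  exact Measurable.ite (measurableSet_lt h.norm measurable_const) measurable_const h.inv

theorem norm_truncResolvent_le (z : ℂ) {δ : ℝ} (hδ : 0 < δ) (x : ℝ) :
    ‖truncResolvent z δ x‖ ≤ δ⁻¹ := by
  unfold truncResolvent
  split_ifs with h
  · simpa using hδ.le
  · rw [norm_inv]
    exact inv_anti₀ hδ (not_lt.1 h)

theorem truncResolvent_mul {z : ℂ} {δ : ℝ} (hδ : 0 < δ) {x : ℝ} (h : ¬ ‖(x : ℂ) - z‖ < δ) :
    (x : ℂ) * truncResolvent z δ x = 1 + z * truncResolvent z δ x := by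
  have h0 : (x : ℂ) - z ≠ 0 := by
    intro hc
    rw [hc, norm_zero] at h
    exact h hδ
  rw [truncResolvent, if_neg h]
  field_simp
  ring

/-- The multiplication by the truncated `(x - z)⁻¹`. It is the resolvent at `z` of multiplication by
the variable if almost every `x` has distance at least `δ` from `z`. -/
def resolvent (z : ℂ) (δ : ℝ) (hδ : 0 < δ) : μ.L2 →L[ℂ] μ.L2 :=
  μ.bddMul (truncResolvent z δ) (measurable_truncResolvent z δ) δ⁻¹ (norm_truncResolvent_le z hδ)

theorem resolvent_mem_mulGraph {z : ℂ} {δ : ℝ} (hδ : 0 < δ)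
    (hz : ∀ᵐ x : ℝ ∂μ.trace, ¬ ‖(x : ℂ) - z‖ < δ) (h : μ.L2) :
    (μ.resolvent z δ hδ h, h + z • μ.resolvent z δ hδ h) ∈ μ.mulGraph := by
  obtain ⟨f, rfl⟩ := SeparationQuotient.surjective_mk h
  obtain ⟨r, hfn, hR⟩ := μ.exists_bddMul_mk (truncResolvent z δ) (measurable_truncResolvent z δ)
    δ⁻¹ (norm_truncResolvent_le z hδ) f
  rw [resolvent, hR]
  have hae : ∀ᵐ x : ℝ ∂μ.trace, (f + z • r).fn x = (x : ℂ) • r.fn x := by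
    filter_upwards [hz] with x hx
    rw [PreL2.fn_add, PreL2.fn_smul, Pi.add_apply, Pi.smul_apply, hfn]
    simp only
    rw [smul_smul, smul_smul, truncResolvent_mul hδ hx, add_smul, one_smul]
  have hm : Measurable fun x : ℝ => (x : ℂ) • r.fn x := Complex.measurable_ofReal.smul r.mem.1
  refine μ.mem_mulGraph.2 ⟨r, ((f + z • r).mem.congr_ae hm hae).toPre, fun x => ?_, ?_, ?_⟩
  · rw [MemL2.fn_toPre]
  · rfl
  rw [← SeparationQuotient.mk_smul, ← SeparationQuotient.mk_add]
  refine (μ.mk_eq_mk_of_ae ?_).symm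
  exact hae

theorem resolvent_of_mem_mulGraph {z : ℂ} {δ : ℝ} (hδ : 0 < δ)
    (hz : ∀ᵐ x : ℝ ∂μ.trace, ¬ ‖(x : ℂ) - z‖ < δ) {p : μ.L2 × μ.L2} (hp : p ∈ μ.mulGraph) :
    μ.resolvent z δ hδ (p.2 - z • p.1) = p.1 := by
  obtain ⟨f, g, h, h1, h2⟩ := hp
  rw [← h1, ← h2]
  refine μ.mk_eq_mk_of_ae (f :=
    ((g - z • f).mem.bdd_smul (measurable_truncResolvent z δ) (norm_truncResolvent_le z hδ)).toPre)
    ?_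
  filter_upwards [hz] with x hx
  change truncResolvent z δ x • (g.fn x - z • f.fn x) = f.fn x
  rw [h, smul_sub, smul_smul, smul_smul, ← sub_smul, mul_comm, truncResolvent_mul hδ hx, mul_comm z,
    add_sub_cancel_right, one_smul]

theorem not_norm_sub_lt_abs_im {z : ℂ} (x : ℝ) : ¬ ‖(x : ℂ) - z‖ < |z.im| := by
  have := Complex.abs_im_le_norm ((x : ℂ) - z)
  simpa using this

/-- Multiplication by the variable is symmetric. -/
theorem mulGraph_symm {p q : μ.L2 × μ.L2} (hp : p ∈ μ.mulGraph) (hq : q ∈ μ.mulGraph) :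
    inner ℂ p.2 q.1 = inner ℂ p.1 q.2 := by
  obtain ⟨f, g, h, h1, h2⟩ := hp
  obtain ⟨f', g', h', h1', h2'⟩ := hq
  rw [← h1, ← h2, ← h1', ← h2', inner_mk, inner_mk]
  refine integral_congr_ae (Filter.Eventually.of_forall fun x => ?_)
  have : star (x : ℂ) = x := Complex.conj_ofReal x
  simp only [h, h', star_smul, smul_dotProduct, Matrix.mulVec_smul, dotProduct_smul, this]

/-- The graph of multiplication by the variable is closed: its points `(f, g)` are those with
`f = (x - i)⁻¹ (g - i f)`. -/
theorem isClosed_mulGraph : IsClosed (μ.mulGraph : Set (μ.L2 × μ.L2)) := by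
  have hz : ∀ᵐ x : ℝ ∂μ.trace, ¬ ‖(x : ℂ) - Complex.I‖ < |Complex.I.im| :=
    Filter.Eventually.of_forall fun x => not_norm_sub_lt_abs_im x
  have hδ : 0 < |Complex.I.im| := by simp
  have : (μ.mulGraph : Set (μ.L2 × μ.L2)) =
      {p | μ.resolvent Complex.I _ hδ (p.2 - Complex.I • p.1) = p.1} := by
    ext p
    refine ⟨fun hp => μ.resolvent_of_mem_mulGraph hδ hz hp, fun hp => ?_⟩
    have := μ.resolvent_mem_mulGraph hδ hz (p.2 - Complex.I • p.1)
    rw [Set.mem_ofPred_eq] at hp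
    rw [hp, sub_add_cancel] at this
    exact this
  rw [this]
  exact isClosed_eq (by fun_prop) (by fun_prop)

end MatrixMeasure

end

/-! ### Measurable Gram–Schmidt orthogonalization -/

noncomputable section

namespace MatrixMeasure

variable {N : ℕ}

/-- The vectors `u 0, …, u (c - 1)` are orthonormal for the semi-definite form `a^* W b`, they span
the first `i` standard basis vectors modulo the kernel of `W`, and all further `u k` vanish. Since
`c ≤ i ≤ N` in all uses, sums over `k < c` may be taken over `k < N`, a range that does not depend
on `W`. -/
structure IsFormBasis (W : Matrix (Fin N) (Fin N) ℂ) (i c : ℕ) (u : ℕ → Fin N → ℂ) : Prop where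
  card_le : c ≤ i
  eq_zero : ∀ k, c ≤ k → u k = 0
  orthonormal : ∀ k l, k < c → l < c → star (u k) ⬝ᵥ (W *ᵥ u l) = if k = l then 1 else 0
  expand : ∀ j : Fin N, (j : ℕ) < i → W *ᵥ Pi.single j 1 =
    ∑ k ∈ Finset.range N, (star (u k) ⬝ᵥ (W *ᵥ Pi.single j 1)) • (W *ᵥ u k)

/-- Hermitian symmetry of the form `a^* W b`. -/
theorem star_form {W : Matrix (Fin N) (Fin N) ℂ} (hW : W.IsHermitian) (a b : Fin N → ℂ) :
    star (star a ⬝ᵥ (W *ᵥ b)) = star b ⬝ᵥ (W *ᵥ a) := by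
  rw [Matrix.star_dotProduct a, Matrix.star_mulVec, hW.eq, ← Matrix.dotProduct_mulVec, star_star]

/-- The component of the `i`-th standard basis vector orthogonal to all the `u k`. -/
def formResidual (W : Matrix (Fin N) (Fin N) ℂ) (i : Fin N) (u : ℕ → Fin N → ℂ) : Fin N → ℂ :=
  Pi.single i 1 - ∑ k ∈ Finset.range N, (star (u k) ⬝ᵥ (W *ᵥ Pi.single i 1)) • u k

theorem IsFormBasis.sum_form {W : Matrix (Fin N) (Fin N) ℂ} {i c : ℕ} {u : ℕ → Fin N → ℂ}
    (h : IsFormBasis W i c u) (hi : i ≤ N) (a : ℕ → ℂ) (l : ℕ) :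
    star (u l) ⬝ᵥ (W *ᵥ ∑ k ∈ Finset.range N, a k • u k) = if l < c then a l else 0 := by
  split_ifs with hl
  · rw [Matrix.mulVec_sum, dotProduct_sum, Finset.sum_eq_single l]
    · rw [Matrix.mulVec_smul, dotProduct_smul, h.orthonormal l l hl hl, if_pos rfl, smul_eq_mul,
        mul_one]
    · intro k _ hk
      rw [Matrix.mulVec_smul, dotProduct_smul]
      by_cases hkc : k < c
      · rw [h.orthonormal l k hl hkc, if_neg hk.symm, smul_zero]
      · rw [h.eq_zero k (not_lt.1 hkc), Matrix.mulVec_zero, dotProduct_zero, smul_zero]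
    · intro hn
      exact absurd (Finset.mem_range.2 (hl.trans_le (h.card_le.trans hi))) hn
  · rw [h.eq_zero l (not_lt.1 hl), star_zero, zero_dotProduct]

theorem IsFormBasis.form_residual {W : Matrix (Fin N) (Fin N) ℂ} {c : ℕ} {i : Fin N}
    {u : ℕ → Fin N → ℂ} (h : IsFormBasis W i c u) (l : ℕ) :
    star (u l) ⬝ᵥ (W *ᵥ formResidual W i u) = 0 := by
  rw [formResidual, Matrix.mulVec_sub, dotProduct_sub, h.sum_form i.2.le]
  split_ifs with hl
  · rw [sub_self]
  · rw [h.eq_zero l (not_lt.1 hl), star_zero, zero_dotProduct, sub_zero]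

theorem mulVec_single_eq (W : Matrix (Fin N) (Fin N) ℂ) (i : Fin N) (u : ℕ → Fin N → ℂ) :
    W *ᵥ Pi.single i 1 = W *ᵥ formResidual W i u +
      ∑ k ∈ Finset.range N, (star (u k) ⬝ᵥ (W *ᵥ Pi.single i 1)) • (W *ᵥ u k) := by
  rw [formResidual, Matrix.mulVec_sub, Matrix.mulVec_sum]
  simp only [Matrix.mulVec_smul]
  rw [sub_add_cancel]

/-- A null residual leaves the system unchanged. -/
theorem IsFormBasis.succ_of_null {W : Matrix (Fin N) (Fin N) ℂ} (hW : W.PosSemidef) {c : ℕ}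
    {i : Fin N} {u : ℕ → Fin N → ℂ} (h : IsFormBasis W i c u)
    (h0 : (star (formResidual W i u) ⬝ᵥ (W *ᵥ formResidual W i u)).re = 0) :
    IsFormBasis W (i + 1) c u := by
  refine ⟨h.card_le.trans (Nat.le_succ _), h.eq_zero, h.orthonormal, fun j hj => ?_⟩
  rcases Nat.lt_succ_iff_lt_or_eq.1 hj with hj | hj
  · exact h.expand j hj
  · obtain rfl := Fin.ext hj
    have h1 : W *ᵥ formResidual W j u = 0 := by
      rw [← hW.dotProduct_mulVec_zero_iff]
      exact Complex.ext h0 (hW.1.im_star_dotProduct_mulVec_self _)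
    have h2 := mulVec_single_eq W j u
    rwa [h1, zero_add] at h2

/-- A residual of positive length is normalized and appended to the system. -/
theorem IsFormBasis.succ_of_pos {W : Matrix (Fin N) (Fin N) ℂ} (hW : W.PosSemidef) {c : ℕ}
    {i : Fin N} {u : ℕ → Fin N → ℂ} (h : IsFormBasis W i c u) {q : ℝ}
    (hq : (star (formResidual W i u) ⬝ᵥ (W *ᵥ formResidual W i u)).re = q) (h0 : q ≠ 0) :
    IsFormBasis W (i + 1) (c + 1)
      (fun k => if k = c then ((√q : ℝ) : ℂ)⁻¹ • formResidual W i u else u k) := by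
  set r := formResidual W i u with hr
  have hq0 : 0 < q := lt_of_le_of_ne (hq ▸ hW.re_dotProduct_nonneg r) h0.symm
  have hs : ((√q : ℝ) : ℂ) ≠ 0 := by
    rw [Complex.ofReal_ne_zero]
    exact (Real.sqrt_pos.2 hq0).ne'
  have hss : ((√q : ℝ) : ℂ) * (√q : ℝ) = q := by
    rw [← Complex.ofReal_mul, Real.mul_self_sqrt hq0.le]
  have hrr : star r ⬝ᵥ (W *ᵥ r) = (q : ℂ) :=
    Complex.ext hq (by rw [Complex.ofReal_im]; exact hW.1.im_star_dotProduct_mulVec_self _)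
  have hstar : star (((√q : ℝ) : ℂ)⁻¹) = ((√q : ℝ) : ℂ)⁻¹ := by
    rw [star_inv₀, Complex.star_def, Complex.conj_ofReal]
  have hur : ∀ l, star (u l) ⬝ᵥ (W *ᵥ r) = 0 := fun l => h.form_residual l
  have hru : ∀ l, star r ⬝ᵥ (W *ᵥ u l) = 0 := fun l => by
    rw [← star_form hW.1, hur, star_zero]
  have hcN : c < N := h.card_le.trans_lt i.2
  -- `u c = 0` before the step, so the expansion of `b` gains exactly the component along `r`
  have hnew : ∀ b : Fin N → ℂ,
      ∑ k ∈ Finset.range N, (star (if k = c then ((√q : ℝ) : ℂ)⁻¹ • r else u k) ⬝ᵥ (W *ᵥ b)) •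
        (W *ᵥ (if k = c then ((√q : ℝ) : ℂ)⁻¹ • r else u k)) =
      ((q : ℂ)⁻¹ * (star r ⬝ᵥ (W *ᵥ b))) • (W *ᵥ r) +
        ∑ k ∈ Finset.range N, (star (u k) ⬝ᵥ (W *ᵥ b)) • (W *ᵥ u k) := by
    intro b
    have hc := Finset.mem_range.2 hcN
    rw [← Finset.add_sum_erase _ _ hc, ← Finset.add_sum_erase (Finset.range N)
      (fun k => (star (u k) ⬝ᵥ (W *ᵥ b)) • (W *ᵥ u k)) hc]
    rw [if_pos rfl, h.eq_zero c le_rfl, Matrix.mulVec_zero, smul_zero, zero_add]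
    congr 1
    · rw [star_smul, hstar, smul_dotProduct, Matrix.mulVec_smul, smul_smul, smul_eq_mul,
        mul_right_comm, ← mul_inv, hss]
    · refine Finset.sum_congr rfl fun k hk => ?_
      rw [if_neg (Finset.ne_of_mem_erase hk)]
  refine ⟨Nat.succ_le_succ h.card_le, fun k hk => ?_, fun k l hk hl => ?_, fun j hj => ?_⟩
  · rw [if_neg (by omega), h.eq_zero k (by omega)]
  · by_cases hkc : k = c <;> by_cases hlc : l = c
    · rw [if_pos hkc, if_pos hlc, if_pos (hkc.trans hlc.symm), star_smul, hstar, smul_dotProduct,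
        Matrix.mulVec_smul, dotProduct_smul, hrr, smul_eq_mul, smul_eq_mul, ← hss]
      field_simp
    · rw [if_pos hkc, if_neg hlc, if_neg (by omega), star_smul, smul_dotProduct, hru, smul_zero]
    · rw [if_neg hkc, if_pos hlc, if_neg (by omega), Matrix.mulVec_smul, dotProduct_smul, hur,
        smul_zero]
    · rw [if_neg hkc, if_neg hlc]
      exact h.orthonormal k l (by omega) (by omega)
  · rw [hnew]
    rcases Nat.lt_succ_iff_lt_or_eq.1 hj with hj | hj
    · have : star r ⬝ᵥ (W *ᵥ Pi.single j 1) = 0 := by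
        rw [h.expand j hj, dotProduct_sum]
        exact Finset.sum_eq_zero fun k _ => by rw [dotProduct_smul, hru, smul_zero]
      rw [this, mul_zero, zero_smul, zero_add]
      exact h.expand j hj
    · obtain rfl := Fin.ext hj
      have h1 : star r ⬝ᵥ (W *ᵥ Pi.single j 1) = q := by
        rw [mulVec_single_eq W j u, dotProduct_add, ← hr, hrr, dotProduct_sum,
          Finset.sum_eq_zero, add_zero]
        exact fun k _ => by rw [dotProduct_smul, hru, smul_zero]
      rw [h1, inv_mul_cancel₀ (by exact_mod_cast h0), one_smul]
      exact mulVec_single_eq W j u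

theorem measurable_bilin {α : Type*} [MeasurableSpace α] {W : α → Matrix (Fin N) (Fin N) ℂ}
    (hW : ∀ i j, Measurable fun x => W x i j) {f g : α → Fin N → ℂ} (hf : Measurable f)
    (hg : Measurable g) : Measurable fun x => star (f x) ⬝ᵥ (W x *ᵥ g x) := by
  simp only [dotProduct, Matrix.mulVec, Pi.star_apply]
  refine Finset.measurable_sum _ fun i _ => Measurable.mul ?_ ?_
  · exact Complex.continuous_conj.measurable.comp (measurable_pi_iff.1 hf i)
  · exact Finset.measurable_sum _ fun j _ => (hW i j).mul (measurable_pi_iff.1 hg j)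

/-- The Gram–Schmidt procedure for the form `a^* W(x) b` can be carried out measurably in `x`. -/
theorem exists_measurable_isFormBasis {α : Type*} [MeasurableSpace α]
    {W : α → Matrix (Fin N) (Fin N) ℂ} (hW : ∀ i j, Measurable fun x => W x i j)
    (i : ℕ) (hi : i ≤ N) :
    ∃ (c : α → ℕ) (u : ℕ → α → Fin N → ℂ), Measurable c ∧ (∀ k, Measurable (u k)) ∧
      ∀ x, (W x).PosSemidef → IsFormBasis (W x) i (c x) (fun k => u k x) := by
  induction i with
  | zero =>
    exact ⟨fun _ => 0, fun _ _ => 0, measurable_const, fun _ => measurable_const,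
      fun x _ => ⟨le_rfl, fun _ _ => rfl, fun k l hk => absurd hk (Nat.not_lt_zero k),
        fun j hj => absurd hj (Nat.not_lt_zero _)⟩⟩
  | succ i ih =>
    obtain ⟨c, u, hc, hu, h⟩ := ih (Nat.le_of_succ_le hi)
    let i' : Fin N := ⟨i, hi⟩
    let r : α → Fin N → ℂ := fun x => formResidual (W x) i' fun k => u k x
    have hr : Measurable r := by
      refine Measurable.sub measurable_const (Finset.measurable_sum _ fun k _ => ?_)
      exact (measurable_bilin hW (hu k) measurable_const).smul (hu k)
    let q : α → ℝ := fun x => (star (r x) ⬝ᵥ (W x *ᵥ r x)).re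
    have hq : Measurable q := Complex.measurable_re.comp (measurable_bilin hW hr hr)
    have hq0 : MeasurableSet {x | q x = 0} := hq (measurableSet_singleton 0)
    classical
    refine ⟨fun x => if q x = 0 then c x else c x + 1,
      fun k x => if q x = 0 then u k x else if k = c x then ((√(q x) : ℝ) : ℂ)⁻¹ • r x else u k x,
      Measurable.ite hq0 hc (hc.add_const 1), fun k => ?_, fun x hx => ?_⟩
    · refine Measurable.ite hq0 (hu k) (Measurable.ite ?_ ?_ (hu k))
      · have := hc (measurableSet_singleton k)
        convert this using 1
        ext x
        exact eq_comm
      · exact (Complex.measurable_ofReal.comp hq.sqrt).inv.smul hr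
    · have hb : IsFormBasis (W x) i' (c x) (fun k => u k x) := h x hx
      by_cases h0 : q x = 0
      · simp only [if_pos h0]
        exact hb.succ_of_null hx h0
      · simp only [if_neg h0]
        exact hb.succ_of_pos hx rfl h0

/-- Modulo the kernel of `W`, every vector is the sum of its components. -/
theorem IsFormBasis.mulVec_eq {W : Matrix (Fin N) (Fin N) ℂ} {c : ℕ} {u : ℕ → Fin N → ℂ}
    (h : IsFormBasis W N c u) (v : Fin N → ℂ) :
    W *ᵥ v = ∑ k ∈ Finset.range N, (star (u k) ⬝ᵥ (W *ᵥ v)) • (W *ᵥ u k) := by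
  have hv : v = ∑ j, v j • (Pi.single j 1 : Fin N → ℂ) := by
    ext i
    simp [Finset.sum_apply, Pi.single_apply]
  rw [hv, Matrix.mulVec_sum]
  simp only [Matrix.mulVec_smul, dotProduct_sum, dotProduct_smul, Finset.sum_smul]
  rw [Finset.sum_comm]
  refine Finset.sum_congr rfl fun j _ => ?_
  rw [h.expand j j.2, Finset.smul_sum]
  refine Finset.sum_congr rfl fun k _ => ?_
  rw [← h.expand j j.2, smul_assoc]

/-- The vectors `W (u k)`, `k < c`, form a basis of the range of `W`. -/
theorem IsFormBasis.rank_eq {W : Matrix (Fin N) (Fin N) ℂ} {c : ℕ} {u : ℕ → Fin N → ℂ}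
    (h : IsFormBasis W N c u) : W.rank = c := by
  have hli : LinearIndependent ℂ fun k : Fin c => W *ᵥ u k := by
    rw [Fintype.linearIndependent_iff]
    intro g hg k
    have h1 := congrArg (fun w => star (u k) ⬝ᵥ w) hg
    simp only [dotProduct_sum, dotProduct_smul, dotProduct_zero] at h1
    rw [Finset.sum_eq_single k, h.orthonormal k k k.2 k.2, if_pos rfl] at h1
    · simpa using h1
    · intro l _ hl
      rw [h.orthonormal k l k.2 l.2, if_neg (fun hc => hl (Fin.ext hc.symm)), smul_zero]
    · simp
  have hspan : LinearMap.range W.mulVecLin =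
      Submodule.span ℂ (Set.range fun k : Fin c => W *ᵥ u k) := by
    refine le_antisymm ?_ (Submodule.span_le.2 ?_)
    · rintro _ ⟨v, rfl⟩
      rw [Matrix.mulVecLin_apply, h.mulVec_eq v]
      refine Submodule.sum_mem _ fun k _ => Submodule.smul_mem _ _ ?_
      by_cases hk : k < c
      · exact Submodule.subset_span ⟨⟨k, hk⟩, rfl⟩
      · rw [h.eq_zero k (not_lt.1 hk), Matrix.mulVec_zero]
        exact Submodule.zero_mem _
    · rintro _ ⟨k, rfl⟩
      exact ⟨u k, rfl⟩
  rw [Matrix.rank, hspan, finrank_span_eq_card hli, Fintype.card_fin]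

/-- The rank of a measurable matrix function is measurable: `W` may be replaced by the positive
semi-definite `W^* W`, for which Gram–Schmidt counts the rank. -/
theorem measurable_rank {α : Type*} [MeasurableSpace α]
    {W : α → Matrix (Fin N) (Fin N) ℂ} (hW : ∀ i j, Measurable fun x => W x i j) :
    Measurable fun x => (W x).rank := by
  have hW2 : ∀ i j, Measurable fun x => ((W x)ᴴ * W x) i j := by
    intro i j
    simp only [Matrix.mul_apply, Matrix.conjTranspose_apply]
    exact Finset.measurable_sum _ fun k _ =>
      (Complex.continuous_conj.measurable.comp (hW k i)).mul (hW k j)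
  obtain ⟨c, u, hc, -, h⟩ := exists_measurable_isFormBasis hW2 N le_rfl
  convert hc using 2 with x
  rw [← Matrix.rank_conjTranspose_mul_self]
  exact (h x (Matrix.posSemidef_conjTranspose_mul_self _)).rank_eq

end MatrixMeasure

end

/-! ### The direct integral decomposition and completeness of `L²_v(μ)` -/

noncomputable section

namespace MatrixMeasure

variable {N : ℕ} (μ : MatrixMeasure N)

theorem exists_frame : ∃ u : ℕ → ℝ → Fin N → ℂ, (∀ k, Measurable (u k)) ∧
    ∀ᵐ x ∂μ.trace, IsFormBasis (μ.density x) N (μ.density x).rank (fun k => u k x) := by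
  obtain ⟨c, u, -, hu, h⟩ := exists_measurable_isFormBasis μ.measurable_density N le_rfl
  refine ⟨u, hu, ?_⟩
  filter_upwards [μ.ae_posSemidef_density] with x hx
  have := h x hx
  rwa [this.rank_eq]

/-- A measurable field of vectors which at almost every `x` is an orthonormal basis for the form
`a^* W(x) b`, indexed by `k < rank W(x)` and continued by zero. -/
def frame : ℕ → ℝ → Fin N → ℂ := μ.exists_frame.choose

theorem measurable_frame (k : ℕ) : Measurable (μ.frame k) := μ.exists_frame.choose_spec.1 k

theorem isFormBasis_frame :
    ∀ᵐ x ∂μ.trace, IsFormBasis (μ.density x) N (μ.density x).rank (fun k => μ.frame k x) :=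
  μ.exists_frame.choose_spec.2

/-- The `k`-th coordinate of `f` with respect to the frame. -/
def coeffAt (f : ℝ → Fin N → ℂ) (k : ℕ) (x : ℝ) : ℂ :=
  star (μ.frame k x) ⬝ᵥ (μ.density x *ᵥ f x)

/-- The coordinate sequence of `f` with respect to the frame, as an element of `ℓ²`. -/
def coordAt (f : ℝ → Fin N → ℂ) (x : ℝ) : lp (fun _ : ℕ => ℂ) 2 :=
  ∑ k ∈ Finset.range N, lp.single 2 k (μ.coeffAt f k x)

theorem coordAt_apply (f : ℝ → Fin N → ℂ) (x : ℝ) (k : ℕ) :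
    μ.coordAt f x k = if k < N then μ.coeffAt f k x else 0 := by
  rw [coordAt, lp.coeFn_sum, Finset.sum_apply]
  simp only [lp.single_apply, Finset.mem_range, Finset.sum_pi_single]

theorem lp_single_eq_smul (k : ℕ) (a : ℂ) :
    lp.single (E := fun _ : ℕ => ℂ) 2 k a = a • lp.single (E := fun _ : ℕ => ℂ) 2 k (1 : ℂ) := by
  rw [← lp.single_smul, smul_eq_mul, mul_one]

theorem stronglyMeasurable_coordAt {f : ℝ → Fin N → ℂ} (hf : Measurable f) :
    StronglyMeasurable (μ.coordAt f) := by
  have : μ.coordAt f = fun x => ∑ k ∈ Finset.range N,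
      μ.coeffAt f k x • lp.single (E := fun _ : ℕ => ℂ) 2 k (1 : ℂ) := by
    funext x
    exact Finset.sum_congr rfl fun k _ => lp_single_eq_smul k _
  rw [this]
  refine Finset.stronglyMeasurable_fun_sum _ fun k _ => StronglyMeasurable.smul_const ?_ _
  exact (μ.measurable_form (μ.measurable_frame k) hf).stronglyMeasurable

theorem norm_sq_coordAt (f : ℝ → Fin N → ℂ) (x : ℝ) :
    ‖μ.coordAt f x‖ ^ 2 = ∑ k ∈ Finset.range N, ‖μ.coeffAt f k x‖ ^ 2 := by
  have := lp.norm_sum_single (E := fun _ : ℕ => ℂ) (p := 2) (by norm_num)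
    (fun k => μ.coeffAt f k x) (Finset.range N)
  rw [coordAt]
  simpa using this

/-- Parseval's identity for the frame. -/
theorem IsFormBasis.form_eq {W : Matrix (Fin N) (Fin N) ℂ} (hW : W.IsHermitian) {c : ℕ}
    {u : ℕ → Fin N → ℂ} (h : IsFormBasis W N c u) (v : Fin N → ℂ) :
    (star v ⬝ᵥ (W *ᵥ v)).re = ∑ k ∈ Finset.range N, ‖star (u k) ⬝ᵥ (W *ᵥ v)‖ ^ 2 := by
  conv_lhs => rw [h.mulVec_eq v]
  rw [dotProduct_sum, Complex.re_sum]
  refine Finset.sum_congr rfl fun k _ => ?_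
  rw [dotProduct_smul, ← star_form hW, smul_eq_mul, Complex.star_def, Complex.conj_mul',
    Complex.norm_conj]
  exact_mod_cast Complex.ofReal_re _

theorem ae_norm_sq_coordAt (f : ℝ → Fin N → ℂ) : ∀ᵐ x ∂μ.trace,
    ‖μ.coordAt f x‖ ^ 2 = (star (f x) ⬝ᵥ (μ.density x *ᵥ f x)).re := by
  filter_upwards [μ.isFormBasis_frame, μ.ae_posSemidef_density] with x hx hW
  rw [norm_sq_coordAt, hx.form_eq hW.1]
  rfl

variable {μ} in
theorem MemL2.memLp_coordAt {f : ℝ → Fin N → ℂ} (hf : μ.MemL2 f) :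
    MemLp (μ.coordAt f) 2 μ.trace := by
  rw [memLp_two_iff_integrable_sq_norm (μ.stronglyMeasurable_coordAt hf.1).aestronglyMeasurable]
  refine hf.2.re.congr ?_
  filter_upwards [μ.ae_norm_sq_coordAt f] with x hx
  exact hx.symm

theorem norm_sq_Lp_two {E : Type*} [NormedAddCommGroup E] [InnerProductSpace ℂ E] (ν : Measure ℝ)
    (g : Lp E 2 ν) : ‖g‖ ^ 2 = ∫ x, ‖g x‖ ^ 2 ∂ν := by
  rw [← inner_self_eq_norm_sq (𝕜 := ℂ), L2.inner_def, ← integral_re (L2.integrable_inner g g)]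
  exact integral_congr_ae (Filter.Eventually.of_forall fun x => inner_self_eq_norm_sq (𝕜 := ℂ) _)

theorem coordAt_add (f g : ℝ → Fin N → ℂ) : μ.coordAt (f + g) = μ.coordAt f + μ.coordAt g := by
  funext x
  refine lp.ext (funext fun k => ?_)
  rw [Pi.add_apply, lp.coeFn_add, Pi.add_apply, coordAt_apply, coordAt_apply, coordAt_apply]
  split_ifs
  · rw [coeffAt, Pi.add_apply, Matrix.mulVec_add, dotProduct_add]; rfl
  · rw [add_zero]

theorem coordAt_smul (φ : ℝ → ℂ) (f : ℝ → Fin N → ℂ) (x : ℝ) :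
    μ.coordAt (fun x => φ x • f x) x = φ x • μ.coordAt f x := by
  refine lp.ext (funext fun k => ?_)
  rw [lp.coeFn_smul, Pi.smul_apply, coordAt_apply, coordAt_apply]
  split_ifs
  · rw [coeffAt, Matrix.mulVec_smul, dotProduct_smul]; rfl
  · rw [smul_zero]

/-- The coordinate map on `𝓛²_v(μ)`. -/
def preCoord : μ.PreL2 →ₗ[ℂ] Lp (lp (fun _ : ℕ => ℂ) 2) 2 μ.trace where
  toFun f := f.mem.memLp_coordAt.toLp _
  map_add' f g := by
    rw [← MemLp.toLp_add]
    refine MemLp.toLp_congr _ _ (Filter.Eventually.of_forall fun x => ?_)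
    rw [PreL2.fn_add, coordAt_add]
  map_smul' c f := by
    rw [RingHom.id_apply, ← MemLp.toLp_const_smul]
    refine MemLp.toLp_congr _ _ (Filter.Eventually.of_forall fun x => ?_)
    exact μ.coordAt_smul (fun _ => c) f.fn x

theorem coeFn_preCoord (f : μ.PreL2) : ∀ᵐ x ∂μ.trace, μ.preCoord f x = μ.coordAt f.fn x :=
  f.mem.memLp_coordAt.coeFn_toLp

theorem norm_preCoord (f : μ.PreL2) : ‖μ.preCoord f‖ = ‖f‖ := by
  rw [← sq_eq_sq₀ (norm_nonneg _) (norm_nonneg _), ← SeparationQuotient.norm_mk f,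
    norm_sq_mk, norm_sq_Lp_two]
  refine integral_congr_ae ?_
  filter_upwards [μ.coeFn_preCoord f, μ.ae_norm_sq_coordAt f.fn] with x h1 h2
  rw [h1, h2]

/-- The isometric embedding of `L²_v(μ)` into the square integrable `ℓ²`-valued functions which maps
`f` to its coordinates with respect to the frame. -/
def coord : μ.L2 →ₗᵢ[ℂ] Lp (lp (fun _ : ℕ => ℂ) 2) 2 μ.trace where
  toLinearMap := (SeparationQuotient.liftCLM
    (μ.preCoord.mkContinuous 1 fun f => by rw [norm_preCoord, one_mul])
    fun f g h => by
      have h1 : ‖f - g‖ = 0 := by rw [← dist_eq_norm]; exact Metric.inseparable_iff.1 h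
      rw [← sub_eq_zero, ← map_sub, ← norm_eq_zero]
      exact (μ.norm_preCoord _).trans h1).toLinearMap
  norm_map' f := by
    obtain ⟨f, rfl⟩ := SeparationQuotient.surjective_mk f
    exact (μ.norm_preCoord f).trans (SeparationQuotient.norm_mk f).symm

theorem coeFn_coord (f : μ.PreL2) :
    ∀ᵐ x ∂μ.trace, μ.coord (SeparationQuotient.mk f) x = μ.coordAt f.fn x :=
  μ.coeFn_preCoord f

/-- The function with given coordinates with respect to the frame. -/
def synthesis (g : ℝ → lp (fun _ : ℕ => ℂ) 2) (x : ℝ) : Fin N → ℂ :=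
  ∑ k ∈ Finset.range N, g x k • μ.frame k x

theorem ae_coeffAt_synthesis (g : ℝ → lp (fun _ : ℕ => ℂ) 2) : ∀ᵐ x ∂μ.trace, ∀ k,
    μ.coeffAt (μ.synthesis g) k x = if k < (μ.density x).rank then g x k else 0 := by
  filter_upwards [μ.isFormBasis_frame] with x hx k
  exact hx.sum_form le_rfl _ k

theorem ae_form_synthesis_le (g : ℝ → lp (fun _ : ℕ => ℂ) 2) : ∀ᵐ x ∂μ.trace,
    (star (μ.synthesis g x) ⬝ᵥ (μ.density x *ᵥ μ.synthesis g x)).re ≤ ‖g x‖ ^ 2 := by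
  filter_upwards [μ.ae_coeffAt_synthesis g, μ.ae_norm_sq_coordAt (μ.synthesis g)] with x h1 h2
  rw [← h2, norm_sq_coordAt]
  have h3 := lp.sum_rpow_le_norm_rpow (E := fun _ : ℕ => ℂ) (p := 2) (by norm_num) (g x)
    (Finset.range N)
  simp only [ENNReal.toReal_ofNat, Real.rpow_ofNat] at h3
  refine (Finset.sum_le_sum fun k _ => ?_).trans h3
  rw [h1]
  split_ifs
  · exact le_rfl
  · simp

theorem measurable_lp_apply {g : ℝ → lp (fun _ : ℕ => ℂ) 2} (hg : StronglyMeasurable g) (k : ℕ) :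
    Measurable fun x => g x k := by
  have h : Continuous fun a : lp (fun _ : ℕ => ℂ) 2 => a k := 
    (lp.evalCLM ℂ (fun _ : ℕ => ℂ) 2 k).continuous
  exact (h.comp_stronglyMeasurable hg).measurable

theorem memL2_synthesis (g : Lp (lp (fun _ : ℕ => ℂ) 2) 2 μ.trace) :
    μ.MemL2 (μ.synthesis g) := by
  have hm : Measurable (μ.synthesis g) :=
    Finset.measurable_sum _ fun k _ =>
      (measurable_lp_apply (Lp.stronglyMeasurable g) k).smul (μ.measurable_frame k)
  refine ⟨hm, ?_⟩
  have hg : Integrable (fun x => ‖g x‖ ^ 2) μ.trace :=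
    (memLp_two_iff_integrable_sq_norm (Lp.aestronglyMeasurable g)).1 (Lp.memLp g)
  refine hg.mono' (μ.measurable_form hm hm).aestronglyMeasurable ?_
  filter_upwards [μ.ae_form_synthesis_le g, μ.ae_posSemidef_density] with x h1 h2
  have h3 : star (μ.synthesis g x) ⬝ᵥ (μ.density x *ᵥ μ.synthesis g x) =
      ((star (μ.synthesis g x) ⬝ᵥ (μ.density x *ᵥ μ.synthesis g x)).re : ℂ) :=
    Complex.ext rfl (by rw [Complex.ofReal_im]; exact h2.1.im_star_dotProduct_mulVec_self _)
  rw [h3, Complex.norm_real]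
  exact (Real.norm_of_nonneg (h2.re_dotProduct_nonneg _)).trans_le h1

/-- Elements of the direct integral are recovered from the functions they synthesize: their
coordinates vanish from the rank of the density on, and so do those of the frame. -/
theorem coord_synthesis {g : Lp (lp (fun _ : ℕ => ℂ) 2) 2 μ.trace}
    (hg : g ∈ directIntegral μ.trace fun x => (μ.density x).rank) :
    μ.coord (SeparationQuotient.mk (μ.memL2_synthesis g).toPre) = g := by
  have hg' : ∀ᵐ x ∂μ.trace, ∀ k, (μ.density x).rank ≤ k → g x k = 0 := hg
  refine Lp.ext ?_
  filter_upwards [μ.coeFn_coord (μ.memL2_synthesis g).toPre, μ.ae_coeffAt_synthesis g, hg',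
    μ.isFormBasis_frame] with x h1 h2 h3 h4
  rw [h1]
  refine lp.ext (funext fun k => ?_)
  rw [coordAt_apply, MemL2.fn_toPre, h2]
  by_cases hk : k < (μ.density x).rank
  · rw [if_pos hk, if_pos (hk.trans_le h4.card_le)]
  · rw [if_neg hk, h3 k (not_lt.1 hk), ite_self]

theorem coord_mem_directIntegral (f : μ.L2) :
    μ.coord f ∈ directIntegral μ.trace fun x => (μ.density x).rank := by
  obtain ⟨f, rfl⟩ := SeparationQuotient.surjective_mk f
  change ∀ᵐ x ∂μ.trace, ∀ k, (μ.density x).rank ≤ k → μ.coord (SeparationQuotient.mk f) x k = 0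
  filter_upwards [μ.coeFn_coord f, μ.isFormBasis_frame] with x h1 h2 k hk
  rw [h1, coordAt_apply, coeffAt, h2.eq_zero k hk, star_zero, zero_dotProduct, ite_self]

/-- `L²_v(μ)` is isometric to the direct integral of the spaces `H_{rank W(x)}`. -/
def directIntegralEquiv :
    μ.L2 ≃ₗᵢ[ℂ] directIntegral μ.trace fun x => (μ.density x).rank :=
  LinearIsometryEquiv.ofSurjective
    { toLinearMap := μ.coord.toLinearMap.codRestrict _ μ.coord_mem_directIntegral
      norm_map' := fun f => μ.coord.norm_map f }
    fun g => ⟨_, Subtype.ext (μ.coord_synthesis g.2)⟩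

variable {μ} in
theorem MemL2.congr_mulVec {f g : ℝ → Fin N → ℂ} (hf : μ.MemL2 f) (hg : Measurable g)
    (h : ∀ᵐ x ∂μ.trace, μ.density x *ᵥ f x = μ.density x *ᵥ g x) : μ.MemL2 g := by
  refine ⟨hg, hf.2.congr ?_⟩
  filter_upwards [h, μ.ae_posSemidef_density] with x hx hW
  rw [hx, ← star_form hW.1, hx, star_form hW.1]

/-- The coordinate map carries multiplication by the variable into multiplication by the
variable. -/
theorem mem_mulGraph_iff_coord (p : μ.L2 × μ.L2) : p ∈ μ.mulGraph ↔
    ∀ᵐ x : ℝ ∂μ.trace, μ.coord p.2 x = (x : ℂ) • μ.coord p.1 x := by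
  constructor
  · rintro ⟨f, g, h, h1, h2⟩
    rw [← h1, ← h2]
    filter_upwards [μ.coeFn_coord f, μ.coeFn_coord g] with x hf hg
    rw [hf, hg, funext h, coordAt_smul μ (fun x => (x : ℂ))]
  · intro hp
    -- the coordinates determine `W g`, so `x f` is a representative of the class of `g`
    obtain ⟨f, hf⟩ := SeparationQuotient.surjective_mk p.1
    obtain ⟨g, hg⟩ := SeparationQuotient.surjective_mk p.2
    rw [← hf, ← hg] at hp
    have hae : ∀ᵐ x : ℝ ∂μ.trace,
        μ.density x *ᵥ g.fn x = μ.density x *ᵥ ((x : ℂ) • f.fn x) := by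
      filter_upwards [hp, μ.coeFn_coord f, μ.coeFn_coord g, μ.isFormBasis_frame]
        with x h1 h2 h3 h4
      rw [h2, h3] at h1
      rw [Matrix.mulVec_smul, h4.mulVec_eq (g.fn x), h4.mulVec_eq (f.fn x), Finset.smul_sum]
      refine Finset.sum_congr rfl fun k hk => ?_
      have h5 := congrArg (fun a : lp (fun _ : ℕ => ℂ) 2 => a k) h1
      simp only [lp.coeFn_smul, Pi.smul_apply, coordAt_apply, if_pos (Finset.mem_range.1 hk)] at h5
      rw [smul_smul]
      exact congrArg (· • _) h5
    have hm : Measurable fun x : ℝ => (x : ℂ) • f.fn x := Complex.measurable_ofReal.smul f.mem.1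
    refine μ.mem_mulGraph.2 ⟨f, (g.mem.congr_mulVec hm hae).toPre, fun x => ?_, hf, ?_⟩
    · rw [MemL2.fn_toPre]
    · rw [← hg, mk_eq_mk_iff]
      filter_upwards [hae] with x hx
      rw [MemL2.fn_toPre, hx]

theorem mem_mulGraph_iff_directIntegralEquiv (f g : μ.L2) : (f, g) ∈ μ.mulGraph ↔
    (μ.directIntegralEquiv f, μ.directIntegralEquiv g) ∈
      directIntegralMulGraph μ.trace fun x => (μ.density x).rank :=
  μ.mem_mulGraph_iff_coord (f, g)

/-- Synthesis, as a linear map into `L²_v(μ)`. -/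
def synthesisMap : Lp (lp (fun _ : ℕ => ℂ) 2) 2 μ.trace →ₗ[ℂ] μ.L2 where
  toFun g := SeparationQuotient.mk (μ.memL2_synthesis g).toPre
  map_add' g h := by
    rw [← SeparationQuotient.mk_add]
    refine μ.mk_eq_mk_of_ae ?_
    filter_upwards [Lp.coeFn_add g h] with x hx
    rw [PreL2.fn_add, Pi.add_apply]
    simp only [MemL2.fn_toPre, synthesis, hx, Pi.add_apply, lp.coeFn_add, add_smul,
      Finset.sum_add_distrib]
  map_smul' c g := by
    rw [RingHom.id_apply, ← SeparationQuotient.mk_smul]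
    refine μ.mk_eq_mk_of_ae ?_
    filter_upwards [Lp.coeFn_smul c g] with x hx
    rw [PreL2.fn_smul, Pi.smul_apply]
    simp only [MemL2.fn_toPre, synthesis, hx, Pi.smul_apply, lp.coeFn_smul, smul_assoc,
      Finset.smul_sum]

theorem norm_synthesisMap_le (g : Lp (lp (fun _ : ℕ => ℂ) 2) 2 μ.trace) :
    ‖μ.synthesisMap g‖ ≤ ‖g‖ := by
  rw [← sq_le_sq₀ (norm_nonneg _) (norm_nonneg _), norm_sq_Lp_two]
  change ‖(SeparationQuotient.mk (μ.memL2_synthesis g).toPre : μ.L2)‖ ^ 2 ≤ _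
  rw [norm_sq_mk]
  refine integral_mono_ae (μ.memL2_synthesis g).2.re
    ((memLp_two_iff_integrable_sq_norm (Lp.aestronglyMeasurable g)).1 (Lp.memLp g)) ?_
  exact μ.ae_form_synthesis_le g

theorem synthesisMap_coord (f : μ.L2) : μ.synthesisMap (μ.coord f) = f :=
  μ.coord.injective (μ.coord_synthesis (μ.coord_mem_directIntegral f))

/-- Completeness: a Cauchy sequence converges in coordinates, and synthesis is continuous. -/
instance : CompleteSpace μ.L2 := by
  refine Metric.complete_of_cauchySeq_tendsto fun s hs => ?_
  obtain ⟨g, hg⟩ := cauchySeq_tendsto_of_complete 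
    (μ.coord.isometry.uniformContinuous.comp_cauchySeq hs)
  refine ⟨μ.synthesisMap g, ?_⟩
  have hc : Continuous μ.synthesisMap :=
    (μ.synthesisMap.mkContinuous 1 fun g => by
      rw [one_mul]; exact μ.norm_synthesisMap_le g).continuous
  refine ((hc.tendsto g).comp hg).congr fun n => ?_
  exact μ.synthesisMap_coord (s n)

/-- On the set where the density vanishes, `μ` vanishes, hence so does its trace. -/
theorem ae_rank_pos : ∀ᵐ x ∂μ.trace, 0 < (μ.density x).rank := by
  have hm : MeasurableSet {x | (μ.density x).rank = 0} :=
    measurable_rank μ.measurable_density (measurableSet_singleton 0)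
  have h0 : μ.toVectorMeasure {x | (μ.density x).rank = 0} = 0 := by
    ext i j
    rw [μ.apply_eq_setIntegral_density hm, Matrix.zero_apply]
    refine setIntegral_eq_zero_of_forall_eq_zero fun x hx => ?_
    have h1 : (μ.density x).mulVecLin = 0 :=
      LinearMap.range_eq_bot.1 (Submodule.finrank_eq_zero.1 hx)
    have h2 := congrFun (LinearMap.congr_fun h1 (Pi.single j 1)) i
    simpa using h2
  have h1 := μ.trace_real_apply hm
  rw [h0, Matrix.trace_zero, Complex.zero_re, measureReal_eq_zero_iff] at h1
  rw [ae_iff]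
  simpa [Nat.pos_iff_ne_zero] using h1

end MatrixMeasure

end

/-! ### Essential self-adjointness of symmetric operators -/

namespace LinearPMap

variable {H : Type} [NormedAddCommGroup H] [InnerProductSpace ℂ H]

/-- A symmetric operator has no eigenvectors for non-real eigenvalues. -/
theorem eq_zero_of_symmetric_of_eigen {x : H} {z : ℂ} (hz : z.im ≠ 0)
    (h : inner ℂ (z • x) x = inner ℂ x (z • x)) : x = 0 := by
  rw [inner_smul_left, inner_smul_right, inner_self_eq_norm_sq_to_K] at h
  by_contra hx
  have hn : ((‖x‖ : ℂ)) ^ 2 ≠ 0 := pow_ne_zero 2 (by exact_mod_cast norm_ne_zero_iff.2 hx)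
  exact hz (Complex.conj_eq_iff_im.1 (mul_right_cancel₀ hn h))

/-- If `⟪x, y⟫` is real, then `⟪x, y - i x⟫` has imaginary part `-‖x‖²`. -/
theorem norm_le_norm_sub_I_smul {x y : H} (h : inner ℂ y x = inner ℂ x y) :
    ‖x‖ ≤ ‖y - Complex.I • x‖ := by
  rcases eq_or_ne x 0 with rfl | hx
  · simp
  have h1 : (inner ℂ x y).im = 0 := by
    rw [← Complex.conj_eq_iff_im, inner_conj_symm, h]
  have h2 : (inner ℂ x (y - Complex.I • x)).im = -‖x‖ ^ 2 := by
    rw [inner_sub_right, inner_smul_right, inner_self_eq_norm_sq_to_K, Complex.sub_im, h1,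
      Complex.I_mul_im, zero_sub]
    norm_cast
  have h3 := (Complex.abs_im_le_norm _).trans (norm_inner_le_norm (𝕜 := ℂ) x (y - Complex.I • x))
  rw [h2, abs_neg, abs_of_nonneg (by positivity), sq] at h3
  exact le_of_mul_le_mul_left h3 (norm_pos_iff.2 hx)

variable [CompleteSpace H] {T : H →ₗ.[ℂ] H}

theorem mem_graph_adjoint_iff (hT : Dense (T.domain : Set H)) {p : H × H} :
    p ∈ T.adjoint.graph ↔ ∀ v : T.domain, inner ℂ (T v) p.1 = inner ℂ (v : H) p.2 := by
  rw [adjoint_graph_eq_graph_adjoint hT, Submodule.mem_adjoint_iff]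
  constructor
  · intro h v
    exact sub_eq_zero.1 (h v (T v) (T.mem_graph v))
  · intro h a b hab
    obtain ⟨v, rfl, rfl⟩ := (mem_graph_iff T).1 hab
    exact sub_eq_zero.2 (h v)

theorem adjoint_closure_eq (hT : Dense (T.domain : Set H)) (hc : T.IsClosable) :
    T.closure.adjoint = T.adjoint := by
  have hT' : Dense (T.closure.domain : Set H) := hT.mono T.le_closure.1
  refine eq_of_eq_graph (le_antisymm (fun p hp => ?_) fun p hp => ?_)
  · rw [adjoint_graph_eq_graph_adjoint hT', Submodule.mem_adjoint_iff] at hp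
    rw [adjoint_graph_eq_graph_adjoint hT, Submodule.mem_adjoint_iff]
    exact fun a b hab => hp a b (le_graph_of_le T.le_closure hab)
  · rw [adjoint_graph_eq_graph_adjoint hT, Submodule.mem_adjoint_iff] at hp
    rw [adjoint_graph_eq_graph_adjoint hT', Submodule.mem_adjoint_iff]
    intro a b hab
    have hcl : _root_.IsClosed {q : H × H | inner ℂ q.2 p.1 - inner ℂ q.1 p.2 = 0} :=
      isClosed_eq (by fun_prop) continuous_const
    have hsub : _root_.closure (T.graph : Set (H × H)) ⊆
        {q : H × H | inner ℂ q.2 p.1 - inner ℂ q.1 p.2 = 0} :=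
      closure_minimal (fun q hq => hp q.1 q.2 hq) hcl
    rw [← hc.graph_closure_eq_closure_graph] at hab
    exact hsub hab

/-- An operator and its closure have the same adjoint, so a self-adjoint closure is the adjoint. -/
theorem adjoint_of_isEssentiallySelfAdjoint (h : IsEssentiallySelfAdjoint T) :
    IsSelfAdjoint T.adjoint ∧ T.closure = T.adjoint := by
  obtain ⟨hT, hc, hs⟩ := h
  have h1 : T.closure = T.adjoint := by
    rw [← adjoint_closure_eq hT hc]
    exact (isSelfAdjoint_def.1 hs).symm
  exact ⟨h1 ▸ hs, h1⟩

/-- The orthogonal complement of the range of `T - z` is the eigenspace of the adjoint at the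
conjugate of `z`. -/
theorem dense_range_sub (hT : Dense (T.domain : Set H)) {z : ℂ}
    (h : ∀ x, (x, star z • x) ∈ T.adjoint.graph → x = 0) :
    Dense (Set.range fun v : T.domain => T v - z • (v : H)) := by
  have : (Set.range fun v : T.domain => T v - z • (v : H)) =
      (LinearMap.range (T.toFun - z • T.domain.subtype) : Set H) := rfl
  rw [this, Submodule.dense_iff_topologicalClosure_eq_top, Submodule.topologicalClosure_eq_top_iff,
    Submodule.eq_bot_iff]
  intro x hx
  refine h x ((mem_graph_adjoint_iff hT).2 fun v => ?_)
  have h1 : inner ℂ (T v - z • (v : H)) x = 0 :=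
    (Submodule.mem_orthogonal _ x).1 hx _ ⟨v, rfl⟩
  rw [inner_sub_left, sub_eq_zero, inner_smul_left] at h1
  rw [h1, inner_smul_right]
  rfl

/-- A densely defined symmetric operator whose adjoint has no eigenvectors for `±i` is essentially
self-adjoint. -/
theorem isEssentiallySelfAdjoint_of_adjoint (hT : Dense (T.domain : Set H))
    (hs : T.IsFormalAdjoint T)
    (h1 : ∀ x, (x, Complex.I • x) ∈ T.adjoint.graph → x = 0)
    (h2 : ∀ x, (x, star Complex.I • x) ∈ T.adjoint.graph → x = 0) :
    IsEssentiallySelfAdjoint T := by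
  have hle : T ≤ T.adjoint := hs.le_adjoint hT
  have hcl : T.adjoint.IsClosed := adjoint_isClosed hT
  have hc : T.IsClosable := hcl.isClosable.leIsClosable hle
  have hgraph : (T.closure.graph : Set (H × H)) = _root_.closure (T.graph : Set (H × H)) := by
    rw [← hc.graph_closure_eq_closure_graph]; rfl
  have hsub : T.closure.graph ≤ T.adjoint.graph := by
    intro p hp
    have hp' : p ∈ _root_.closure (T.graph : Set (H × H)) := hgraph ▸ hp
    exact _root_.closure_minimal (le_graph_of_le hle) hcl hp'
  -- the range of `T.closure - i` is everything, as `T - i` is bounded below with dense range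
  have hsurj : ∀ y : H, ∃ x, (x, y + Complex.I • x) ∈ T.closure.graph := by
    intro y
    obtain ⟨s, hs1, hs2⟩ := mem_closure_iff_seq_limit.1 (dense_range_sub hT h2 y)
    choose v hv using hs1
    have hcau : CauchySeq fun n => (v n : H) := by
      refine Metric.cauchySeq_iff'.2 fun ε hε => ?_
      obtain ⟨n₀, hn⟩ := Metric.cauchySeq_iff'.1 hs2.cauchySeq ε hε
      refine ⟨n₀, fun n h => lt_of_le_of_lt ?_ (hn n h)⟩
      rw [dist_eq_norm, dist_eq_norm, ← hv, ← hv]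
      have := norm_le_norm_sub_I_smul (hs (v n - v n₀) (v n - v n₀))
      rw [map_sub, Submodule.coe_sub] at this
      refine this.trans_eq (congrArg norm ?_)
      simp only [smul_sub]
      abel
    obtain ⟨x, hx⟩ := cauchySeq_tendsto_of_complete hcau
    refine ⟨x, ?_⟩
    change _ ∈ (T.closure.graph : Set (H × H))
    rw [hgraph]
    refine mem_closure_of_tendsto (hx.prodMk_nhds (hs2.add (hx.const_smul Complex.I)))
      (Filter.Eventually.of_forall fun n => ?_)
    rw [← hv]
    simp only [sub_add_cancel]
    exact T.mem_graph (v n)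
  have heq : T.closure = T.adjoint := by
    refine eq_of_eq_graph (le_antisymm hsub fun p hp => ?_)
    -- `p` differs from a point of the closure by an eigenvector of the adjoint at `i`
    obtain ⟨x, hx⟩ := hsurj (p.2 - Complex.I • p.1)
    have h3 := T.adjoint.graph.sub_mem hp (hsub hx)
    have h4 : p - (x, p.2 - Complex.I • p.1 + Complex.I • x) =
        (p.1 - x, Complex.I • (p.1 - x)) := by
      refine Prod.ext rfl ?_
      simp only [Prod.snd_sub, smul_sub]
      abel
    rw [h4] at h3
    obtain rfl := sub_eq_zero.1 (h1 _ h3)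
    rwa [sub_add_cancel] at hx
  refine ⟨hT, hc, ?_⟩
  rw [isSelfAdjoint_def, adjoint_closure_eq hT hc, heq]

/-- The operator `T - z` has dense range for non-real `z`, if `T` is essentially self-adjoint. -/
theorem dense_range_sub_of_isEssentiallySelfAdjoint (h : IsEssentiallySelfAdjoint T) {z : ℂ}
    (hz : z.im ≠ 0) : Dense (Set.range fun v : T.domain => T v - z • (v : H)) := by
  refine dense_range_sub h.1 fun x hx => ?_
  have hsa := (adjoint_of_isEssentiallySelfAdjoint h).1
  have hx2 := hx
  rw [← isSelfAdjoint_def.1 hsa, mem_graph_adjoint_iff hsa.dense_domain] at hx2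
  obtain ⟨v, hv1, hv2⟩ := (mem_graph_iff _).1 hx
  have := hx2 v
  rw [hv1, hv2] at this
  exact eq_zero_of_symmetric_of_eigen (z := star z) (by simpa using hz) this

end LinearPMap

/-! ### Matrix polynomials and the three-term recurrence -/

noncomputable section

namespace MatrixMeasure

variable {N : ℕ}

section Eval

variable (Q R : Polynomial (Matrix (Fin N) (Fin N) ℂ)) (z : ℂ)

theorem evalAt_add : evalAt (Q + R) z = evalAt Q z + evalAt R z := Polynomial.eval_add

theorem evalAt_C_mul (c : Matrix (Fin N) (Fin N) ℂ) :
    evalAt (Polynomial.C c * Q) z = c * evalAt Q z := Polynomial.eval_C_mul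

theorem evalAt_X_mul : evalAt (Polynomial.X * Q) z = z • evalAt Q z := by
  rw [evalAt, Polynomial.X_mul, Polynomial.eval_mul_X, Matrix.scalar_apply]
  exact (Matrix.smul_eq_mul_diagonal _ z).symm

end Eval

variable {μ : MatrixMeasure N} (hμ : μ.HasPosDefEvenMoments)

/-- The class of `x ↦ Q(x)^* v` in `L²_v(μ)`. -/
def polyVec (Q : Polynomial (Matrix (Fin N) (Fin N) ℂ)) (v : Fin N → ℂ) : μ.L2 :=
  SeparationQuotient.mk (hμ.memL2 Q v).toPre

theorem polyVec_congr {Q R : Polynomial (Matrix (Fin N) (Fin N) ℂ)} {v w : Fin N → ℂ}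
    (h : ∀ x : ℝ, (evalAt Q x)ᴴ *ᵥ v = (evalAt R x)ᴴ *ᵥ w) :
    polyVec hμ Q v = polyVec hμ R w :=
  μ.mk_eq_mk_of_ae (Filter.Eventually.of_forall h)

theorem polyVec_add_right (Q : Polynomial (Matrix (Fin N) (Fin N) ℂ)) (v w : Fin N → ℂ) :
    polyVec hμ Q (v + w) = polyVec hμ Q v + polyVec hμ Q w := by
  rw [polyVec, polyVec, polyVec, ← SeparationQuotient.mk_add]
  refine μ.mk_eq_mk_of_ae (Filter.Eventually.of_forall fun x => ?_)
  rw [PreL2.fn_add, Pi.add_apply]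
  simp only [MemL2.fn_toPre, Matrix.mulVec_add]

theorem polyVec_smul_right (Q : Polynomial (Matrix (Fin N) (Fin N) ℂ)) (c : ℂ) (v : Fin N → ℂ) :
    polyVec hμ Q (c • v) = c • polyVec hμ Q v := by
  rw [polyVec, polyVec, ← SeparationQuotient.mk_smul]
  refine μ.mk_eq_mk_of_ae (Filter.Eventually.of_forall fun x => ?_)
  rw [PreL2.fn_smul, Pi.smul_apply]
  simp only [MemL2.fn_toPre, Matrix.mulVec_smul]

theorem polyVec_add_left (Q R : Polynomial (Matrix (Fin N) (Fin N) ℂ)) (v : Fin N → ℂ) :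
    polyVec hμ (Q + R) v = polyVec hμ Q v + polyVec hμ R v := by
  rw [polyVec, polyVec, polyVec, ← SeparationQuotient.mk_add]
  refine μ.mk_eq_mk_of_ae (Filter.Eventually.of_forall fun x => ?_)
  rw [PreL2.fn_add, Pi.add_apply]
  simp only [MemL2.fn_toPre, evalAt_add, Matrix.conjTranspose_add, Matrix.add_mulVec]

theorem polyVec_C_mul (c : Matrix (Fin N) (Fin N) ℂ)
    (Q : Polynomial (Matrix (Fin N) (Fin N) ℂ)) (v : Fin N → ℂ) :
    polyVec hμ (Polynomial.C c * Q) v = polyVec hμ Q (cᴴ *ᵥ v) :=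
  polyVec_congr hμ fun x => by
    rw [evalAt_C_mul, Matrix.conjTranspose_mul, Matrix.mulVec_mulVec]

theorem polyVec_X_mul_mem (Q : Polynomial (Matrix (Fin N) (Fin N) ℂ)) (v : Fin N → ℂ) :
    (polyVec hμ Q v, polyVec hμ (Polynomial.X * Q) v) ∈ μ.mulGraph := by
  refine μ.mem_mulGraph.2 ⟨(hμ.memL2 Q v).toPre, (hμ.memL2 (Polynomial.X * Q) v).toPre,
    fun x => ?_, rfl, rfl⟩
  rw [MemL2.fn_toPre, MemL2.fn_toPre]
  simp only [evalAt_X_mul, Matrix.conjTranspose_smul, Matrix.smul_mulVec, Complex.star_def,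
    Complex.conj_ofReal]

variable (μ) in
/-- The matrix-valued inner product `∫ Q W R^* dτ_μ` of two matrix polynomials. -/
def pairing (Q R : Polynomial (Matrix (Fin N) (Fin N) ℂ)) : Matrix (Fin N) (Fin N) ℂ :=
  μ.matrixIntegral fun x => evalAt Q x * μ.density x * (evalAt R x)ᴴ

theorem form_conjTranspose_mulVec (A W B : Matrix (Fin N) (Fin N) ℂ) (a b : Fin N → ℂ) :
    star (Aᴴ *ᵥ a) ⬝ᵥ (W *ᵥ (Bᴴ *ᵥ b)) = star a ⬝ᵥ ((A * W * Bᴴ) *ᵥ b) := by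
  rw [Matrix.star_mulVec, Matrix.conjTranspose_conjTranspose, ← Matrix.dotProduct_mulVec,
    Matrix.mulVec_mulVec, Matrix.mulVec_mulVec, Matrix.mul_assoc]

theorem star_single_dotProduct_mulVec_single (M : Matrix (Fin N) (Fin N) ℂ) (i j : Fin N) :
    star (Pi.single i 1 : Fin N → ℂ) ⬝ᵥ (M *ᵥ Pi.single j 1) = M i j := by
  rw [Matrix.mulVec_single_one, ← Pi.single_star, star_one, single_one_dotProduct]
  rfl

include hμ in
theorem integrable_pairing (Q R : Polynomial (Matrix (Fin N) (Fin N) ℂ)) (i j : Fin N) :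
    Integrable (fun x : ℝ => (evalAt Q x * μ.density x * (evalAt R x)ᴴ) i j) μ.trace := by
  have := (hμ.memL2 Q (Pi.single i 1)).integrable_form (hμ.memL2 R (Pi.single j 1))
  simpa only [form_conjTranspose_mulVec, star_single_dotProduct_mulVec_single] using this

theorem inner_polyVec (Q R : Polynomial (Matrix (Fin N) (Fin N) ℂ)) (a b : Fin N → ℂ) :
    inner ℂ (polyVec hμ Q a) (polyVec hμ R b) = star a ⬝ᵥ (μ.pairing Q R *ᵥ b) := by
  rw [polyVec, polyVec, inner_mk]
  simp only [MemL2.fn_toPre, form_conjTranspose_mulVec]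
  have hi : ∀ i j : Fin N, Integrable (fun x : ℝ =>
      star (a i) * ((evalAt Q x * μ.density x * (evalAt R x)ᴴ) i j * b j)) μ.trace := fun i j =>
    ((integrable_pairing hμ Q R i j).mul_const _).const_mul _
  simp only [dotProduct, Matrix.mulVec, Finset.mul_sum, Pi.star_apply]
  rw [integral_finsetSum _ fun i _ => integrable_finsetSum _ fun j _ => hi i j]
  refine Finset.sum_congr rfl fun i _ => ?_
  rw [integral_finsetSum _ fun j _ => hi i j]
  refine Finset.sum_congr rfl fun j _ => ?_
  rw [integral_const_mul, integral_mul_const]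
  rfl

theorem pairing_apply (Q R : Polynomial (Matrix (Fin N) (Fin N) ℂ)) (i j : Fin N) :
    μ.pairing Q R i j = inner ℂ (polyVec hμ Q (Pi.single i 1)) (polyVec hμ R (Pi.single j 1)) := by
  rw [inner_polyVec, star_single_dotProduct_mulVec_single]

include hμ in
theorem pairing_add_left (Q Q' R : Polynomial (Matrix (Fin N) (Fin N) ℂ)) :
    μ.pairing (Q + Q') R = μ.pairing Q R + μ.pairing Q' R := by
  ext i j
  rw [Matrix.add_apply, pairing_apply hμ, pairing_apply hμ, pairing_apply hμ, polyVec_add_left,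
    inner_add_left]

include hμ in
theorem pairing_C_mul_left (c : Matrix (Fin N) (Fin N) ℂ)
    (Q R : Polynomial (Matrix (Fin N) (Fin N) ℂ)) :
    μ.pairing (Polynomial.C c * Q) R = c * μ.pairing Q R := by
  ext i j
  rw [pairing_apply hμ, polyVec_C_mul, inner_polyVec, Matrix.star_mulVec,
    Matrix.conjTranspose_conjTranspose, ← Matrix.dotProduct_mulVec, Matrix.mulVec_mulVec,
    star_single_dotProduct_mulVec_single]

include hμ in
theorem pairing_X_mul (Q R : Polynomial (Matrix (Fin N) (Fin N) ℂ)) :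
    μ.pairing (Polynomial.X * Q) R = μ.pairing Q (Polynomial.X * R) := by
  ext i j
  rw [pairing_apply hμ, pairing_apply hμ]
  exact μ.mulGraph_symm (polyVec_X_mul_mem hμ Q _) (polyVec_X_mul_mem hμ R _)

include hμ in
theorem pairing_conjTranspose (Q R : Polynomial (Matrix (Fin N) (Fin N) ℂ)) :
    (μ.pairing Q R)ᴴ = μ.pairing R Q := by
  ext i j
  rw [Matrix.conjTranspose_apply, pairing_apply hμ, pairing_apply hμ]
  exact inner_conj_symm _ _

include hμ in
theorem pairing_sum_left {ι : Type*} (s : Finset ι)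
    (Q : ι → Polynomial (Matrix (Fin N) (Fin N) ℂ)) (R : Polynomial (Matrix (Fin N) (Fin N) ℂ)) :
    μ.pairing (∑ k ∈ s, Q k) R = ∑ k ∈ s, μ.pairing (Q k) R :=
  map_sum (AddMonoidHom.mk' (fun Q => μ.pairing Q R) fun Q Q' => pairing_add_left hμ Q Q' R) Q s

theorem matrixIntegral_smul_eq_pairing (Q R : Polynomial (Matrix (Fin N) (Fin N) ℂ)) :
    (μ.matrixIntegral fun x => (x : ℂ) • (evalAt Q x * μ.density x * (evalAt R x)ᴴ)) =
      μ.pairing (Polynomial.X * Q) R := by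
  rw [pairing]
  simp only [evalAt_X_mul, Matrix.smul_mul]

section Orthonormal

variable {P : ℕ → Polynomial (Matrix (Fin N) (Fin N) ℂ)} (hP : μ.IsOrthonormalPolys P)

theorem jacobiA_eq (n : ℕ) : μ.jacobiA P n = μ.pairing (Polynomial.X * P n) (P (n + 1)) :=
  matrixIntegral_smul_eq_pairing _ _

theorem jacobiB_eq (n : ℕ) : μ.jacobiB P n = μ.pairing (Polynomial.X * P n) (P n) :=
  matrixIntegral_smul_eq_pairing _ _

include hP in
theorem pairing_orthonormal (n m : ℕ) : μ.pairing (P n) (P m) = if n = m then 1 else 0 :=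
  hP.orthonormal n m

include hP in
/-- Since the leading coefficients are invertible, every polynomial of degree less than `m` is a
left linear combination of `P 0, …, P (m - 1)`. -/
theorem exists_expansion (m : ℕ) (Q : Polynomial (Matrix (Fin N) (Fin N) ℂ))
    (hQ : ∀ k, m ≤ k → Q.coeff k = 0) :
    ∃ c : ℕ → Matrix (Fin N) (Fin N) ℂ, Q = ∑ k ∈ Finset.range m, Polynomial.C (c k) * P k := by
  induction m generalizing Q with
  | zero =>
    refine ⟨0, ?_⟩
    rw [Finset.range_zero, Finset.sum_empty]
    exact Polynomial.ext fun k => hQ k (Nat.zero_le k)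
  | succ m ih =>
    obtain ⟨b, hb⟩ := (hP.isUnit_coeff m).exists_left_inv
    obtain ⟨c, hc⟩ := ih (Q - Polynomial.C (Q.coeff m * b) * P m) fun k hk => by
      rw [Polynomial.coeff_sub, Polynomial.coeff_C_mul]
      rcases hk.eq_or_lt with rfl | hk
      · rw [mul_assoc, hb, mul_one, sub_self]
      · rw [hQ k hk, Polynomial.coeff_eq_zero_of_natDegree_lt ((hP.natDegree_le m).trans_lt hk),
          mul_zero, sub_zero]
    refine ⟨fun k => if k = m then Q.coeff m * b else c k, ?_⟩
    simp only
    rw [Finset.sum_range_succ, if_pos rfl, Finset.sum_congr rfl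
      (g := fun k => Polynomial.C (c k) * P k), ← hc, sub_add_cancel]
    intro k hk
    rw [if_neg (Finset.mem_range.1 hk).ne]

include hμ hP

/-- The coefficients with respect to the orthonormal polynomials are Fourier coefficients. -/
theorem expansion (m : ℕ) (Q : Polynomial (Matrix (Fin N) (Fin N) ℂ))
    (hQ : ∀ k, m ≤ k → Q.coeff k = 0) :
    Q = ∑ k ∈ Finset.range m, Polynomial.C (μ.pairing Q (P k)) * P k := by
  obtain ⟨c, hc⟩ := exists_expansion hP m Q hQ
  conv_lhs => rw [hc]
  refine Finset.sum_congr rfl fun k hk => ?_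
  have : μ.pairing Q (P k) = c k := by
    rw [hc, pairing_sum_left hμ, Finset.sum_eq_single k]
    · rw [pairing_C_mul_left hμ, pairing_orthonormal hP, if_pos rfl, mul_one]
    · intro l _ hl
      rw [pairing_C_mul_left hμ, pairing_orthonormal hP, if_neg hl, mul_zero]
    · exact fun h => absurd hk h
  rw [this]

theorem pairing_eq_zero {m l : ℕ} (hml : m ≤ l) (Q : Polynomial (Matrix (Fin N) (Fin N) ℂ))
    (hQ : ∀ k, m ≤ k → Q.coeff k = 0) : μ.pairing Q (P l) = 0 := by
  obtain ⟨c, hc⟩ := exists_expansion hP m Q hQ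
  rw [hc, pairing_sum_left hμ]
  refine Finset.sum_eq_zero fun k hk => ?_
  rw [pairing_C_mul_left hμ, pairing_orthonormal hP,
    if_neg ((Finset.mem_range.1 hk).trans_le hml).ne, mul_zero]

omit hμ in
theorem coeff_X_mul_eq_zero (n k : ℕ) (hk : n + 2 ≤ k) : (Polynomial.X * P n).coeff k = 0 := by
  obtain ⟨k, rfl⟩ := Nat.exists_eq_add_of_le' (show 1 ≤ k by omega)
  rw [Polynomial.coeff_X_mul]
  exact Polynomial.coeff_eq_zero_of_natDegree_lt ((hP.natDegree_le n).trans_lt (by omega))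

omit hP in
theorem isHermitian_jacobiB (n : ℕ) : (μ.jacobiB P n).IsHermitian := by
  rw [Matrix.IsHermitian, jacobiB_eq, pairing_conjTranspose hμ, pairing_X_mul hμ]

theorem X_mul_zero : Polynomial.X * P 0 =
    Polynomial.C (μ.jacobiA P 0) * P 1 + Polynomial.C (μ.jacobiB P 0) * P 0 := by
  rw [jacobiA_eq, jacobiB_eq]
  have h := expansion hμ hP 2 _ (coeff_X_mul_eq_zero hP 0)
  rw [Finset.sum_range_succ, Finset.sum_range_succ, Finset.sum_range_zero, zero_add, add_comm] at h
  exact h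

theorem X_mul_succ (n : ℕ) : Polynomial.X * P (n + 1) =
    Polynomial.C (μ.jacobiA P (n + 1)) * P (n + 2) +
      Polynomial.C (μ.jacobiB P (n + 1)) * P (n + 1) + Polynomial.C (μ.jacobiA P n)ᴴ * P n := by
  rw [jacobiA_eq, jacobiB_eq, jacobiA_eq, pairing_conjTranspose hμ, ← pairing_X_mul hμ]
  have h := expansion hμ hP (n + 3) _ (coeff_X_mul_eq_zero hP (n + 1))
  rw [Finset.sum_range_succ, Finset.sum_range_succ, Finset.sum_range_succ, Finset.sum_eq_zero,
    zero_add] at h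
  · refine h.trans ?_
    abel
  · -- for `k < n`, `X * P k` has degree less than `n + 1`, so it is orthogonal to `P (n + 1)`
    intro k hk
    rw [← pairing_conjTranspose hμ, ← pairing_X_mul hμ,
      pairing_eq_zero hμ hP (Nat.succ_le_succ (Finset.mem_range.1 hk)) _
        (coeff_X_mul_eq_zero hP k), Matrix.conjTranspose_zero, map_zero, zero_mul]

/-- Comparing leading coefficients in the recurrence. -/
theorem coeff_eq_jacobiA_mul (n : ℕ) :
    (P n).coeff n = μ.jacobiA P n * (P (n + 1)).coeff (n + 1) := by
  have h0 : ∀ k l, k < l → (P k).coeff l = 0 := fun k l hkl =>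
    Polynomial.coeff_eq_zero_of_natDegree_lt ((hP.natDegree_le k).trans_lt hkl)
  rw [← Polynomial.coeff_X_mul]
  cases n with
  | zero =>
    rw [X_mul_zero hμ hP, Polynomial.coeff_add, Polynomial.coeff_C_mul, Polynomial.coeff_C_mul,
      h0 0 (0 + 1) (by omega), mul_zero, add_zero]
  | succ n =>
    rw [X_mul_succ hμ hP, Polynomial.coeff_add, Polynomial.coeff_add, Polynomial.coeff_C_mul,
      Polynomial.coeff_C_mul, Polynomial.coeff_C_mul, h0 (n + 1) (n + 1 + 1) (by omega),
      h0 n (n + 1 + 1) (by omega), mul_zero, mul_zero, add_zero, add_zero]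

theorem det_jacobiA_ne_zero (n : ℕ) : (μ.jacobiA P n).det ≠ 0 := by
  have h := hP.isUnit_coeff n
  rw [coeff_eq_jacobiA_mul hμ hP, Matrix.isUnit_iff_isUnit_det, Matrix.det_mul] at h
  exact (isUnit_of_mul_isUnit_left h).ne_zero

theorem recurrence_zero (z : ℂ) : z • evalAt (P 0) z =
    μ.jacobiA P 0 * evalAt (P 1) z + μ.jacobiB P 0 * evalAt (P 0) z := by
  rw [← evalAt_X_mul, X_mul_zero hμ hP, evalAt_add, evalAt_C_mul, evalAt_C_mul]

theorem recurrence_succ (n : ℕ) (z : ℂ) : z • evalAt (P (n + 1)) z =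
    μ.jacobiA P (n + 1) * evalAt (P (n + 2)) z + μ.jacobiB P (n + 1) * evalAt (P (n + 1)) z +
      (μ.jacobiA P n)ᴴ * evalAt (P n) z := by
  rw [← evalAt_X_mul, X_mul_succ hμ hP, evalAt_add, evalAt_add, evalAt_C_mul, evalAt_C_mul,
    evalAt_C_mul]

end Orthonormal

end MatrixMeasure

end

/-! ### The Jacobi operator and its embedding into `L²_v(μ)` -/

noncomputable section

section JacobiOperator

variable {N : ℕ} {A B : ℕ → Matrix (Fin N) (Fin N) ℂ}

theorem lp_single_mem_finiteSequences (n : ℕ) (v : EuclideanSpace ℂ (Fin N)) :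
    (lp.single 2 n v : Ell2 N) ∈ finiteSequences N := by
  refine (Set.finite_singleton n).subset fun k hk => ?_
  by_contra hc
  exact hk (lp.single_apply_ne (E := fun _ : ℕ => EuclideanSpace ℂ (Fin N)) 2 n v hc)

theorem dense_finiteSequences (N : ℕ) : Dense (finiteSequences N : Set (Ell2 N)) := fun V =>
  mem_closure_of_tendsto (lp.hasSum_single (by norm_num) V) (Filter.Eventually.of_forall fun _ =>
    Submodule.sum_mem _ fun n _ => lp_single_mem_finiteSequences n (V n))

theorem inner_toLpLin (M : Matrix (Fin N) (Fin N) ℂ) (v w : EuclideanSpace ℂ (Fin N)) :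
    inner ℂ (Matrix.toLpLin 2 2 M v) w = inner ℂ v (Matrix.toLpLin 2 2 Mᴴ w) := by
  rw [EuclideanSpace.inner_eq_star_dotProduct, EuclideanSpace.inner_eq_star_dotProduct,
    Matrix.ofLp_toLpLin, Matrix.ofLp_toLpLin, Matrix.toLin'_apply, Matrix.toLin'_apply,
    Matrix.star_mulVec, dotProduct_comm, ← Matrix.dotProduct_mulVec, dotProduct_comm]

/-- Green's formula for the block Jacobi matrix. -/
theorem sum_inner_jacobiAction (hB : ∀ n, (B n).IsHermitian)
    (v w : ℕ → EuclideanSpace ℂ (Fin N)) (m : ℕ) :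
    ∑ n ∈ Finset.range (m + 1), inner ℂ (jacobiAction A B w n) (v n) =
      ∑ n ∈ Finset.range (m + 1), inner ℂ (w n) (jacobiAction A B v n) +
        inner ℂ (Matrix.toLpLin 2 2 (A m) (w (m + 1))) (v m) -
        inner ℂ (w m) (Matrix.toLpLin 2 2 (A m) (v (m + 1))) := by
  induction m with
  | zero =>
    simp only [zero_add, Finset.range_one, Finset.sum_singleton, jacobiAction, inner_add_left,
      inner_add_right]
    rw [inner_toLpLin (B 0), (hB 0).eq]
    ring
  | succ m ih =>
    rw [Finset.sum_range_succ, ih, Finset.sum_range_succ _ (m + 1)]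
    simp only [jacobiAction, inner_add_left, inner_add_right]
    rw [inner_toLpLin (B (m + 1)), (hB (m + 1)).eq, inner_toLpLin (A m)ᴴ,
      Matrix.conjTranspose_conjTranspose, inner_toLpLin (A m)]
    ring

theorem exists_forall_lt_eq_zero {V : Ell2 N} (hV : V ∈ finiteSequences N) :
    ∃ m, ∀ n, m < n → V n = 0 := by
  obtain ⟨m, hm⟩ := Set.Finite.bddAbove (show {n | V n ≠ 0}.Finite from hV)
  refine ⟨m, fun n hn => ?_⟩
  by_contra hc
  exact absurd (hm hc) (not_le.2 hn)

theorem jacobiAction_eq_zero {v : ℕ → EuclideanSpace ℂ (Fin N)} {m : ℕ}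
    (hv : ∀ n, m < n → v n = 0) {n : ℕ} (hn : m + 1 < n) : jacobiAction A B v n = 0 := by
  cases n with
  | zero => omega
  | succ n => simp [jacobiAction, hv n (by omega), hv (n + 1) (by omega), hv (n + 2) (by omega)]

/-- For finitely supported `W`, the boundary terms in Green's formula vanish, whatever `V` is. -/
theorem inner_jacobiOp (hB : ∀ n, (B n).IsHermitian) (W : (jacobiOp A B).domain) (V : Ell2 N)
    {m : ℕ} (hm : ∀ n, m < n → (W : Ell2 N) n = 0) :
    inner ℂ (jacobiOp A B W) V =
      ∑ n ∈ Finset.range (m + 2), inner ℂ ((W : Ell2 N) n) (jacobiAction A B V n) := by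
  have h1 : inner ℂ (jacobiOp A B W) V =
      ∑ n ∈ Finset.range (m + 2), inner ℂ (jacobiAction A B (W : Ell2 N) n) (V n) := by
    rw [lp.inner_eq_tsum]
    refine tsum_eq_sum fun n hn => ?_
    change inner ℂ (jacobiAction A B (W : Ell2 N) n) (V n) = 0
    rw [jacobiAction_eq_zero hm (by rw [Finset.mem_range] at hn; omega), inner_zero_left]
  rw [h1, sum_inner_jacobiAction hB, hm (m + 1) (by omega), hm (m + 1 + 1) (by omega), map_zero,
    inner_zero_left, inner_zero_left, add_zero, sub_zero]

/-- The adjoint of the Jacobi operator acts by the Jacobi matrix. -/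
theorem jacobiAction_eq_of_mem_adjoint (hB : ∀ n, (B n).IsHermitian) {p : Ell2 N × Ell2 N}
    (hp : p ∈ (jacobiOp A B).adjoint.graph) (n : ℕ) : p.2 n = jacobiAction A B p.1 n := by
  rw [LinearPMap.mem_graph_adjoint_iff (dense_finiteSequences N)] at hp
  refine ext_inner_left ℂ fun e => ?_
  have h := hp ⟨lp.single 2 n e, lp_single_mem_finiteSequences n e⟩
  have hs : ∀ k, k ≠ n → (lp.single 2 n e : Ell2 N) k = 0 := fun k hk =>
    lp.single_apply_ne (E := fun _ : ℕ => EuclideanSpace ℂ (Fin N)) 2 n e hk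
  have hn : (lp.single 2 n e : Ell2 N) n = e :=
    lp.single_apply_self (E := fun _ : ℕ => EuclideanSpace ℂ (Fin N)) 2 n e
  rw [inner_jacobiOp hB _ _ (m := n) fun k hk => hs k hk.ne', lp.inner_single_left,
    Finset.sum_eq_single n] at h
  · simpa only [hn] using h.symm
  · intro k _ hk
    change inner ℂ ((lp.single 2 n e : Ell2 N) k) _ = 0
    rw [hs k hk, inner_zero_left]
  · intro hc
    exact absurd (Finset.mem_range.2 (by omega)) hc

theorem toLpLin_injective {M : Matrix (Fin N) (Fin N) ℂ} (hM : M.det ≠ 0) :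
    Function.Injective (Matrix.toLpLin 2 2 M) := by
  intro v w h
  have h1 := congrArg WithLp.ofLp h
  rw [Matrix.ofLp_toLpLin, Matrix.ofLp_toLpLin, Matrix.toLin'_apply, Matrix.toLin'_apply] at h1
  have h2 := Matrix.mulVec_injective_of_isUnit
    ((Matrix.isUnit_iff_isUnit_det M).2 (isUnit_iff_ne_zero.2 hM)) h1
  exact WithLp.ofLp_injective 2 h2

/-- A solution of the three-term recurrence is determined by its initial value. -/
theorem eq_of_jacobiAction_eq (hA : ∀ n, (A n).det ≠ 0) {z : ℂ}
    {v w : ℕ → EuclideanSpace ℂ (Fin N)} (hv : ∀ n, z • v n = jacobiAction A B v n)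
    (hw : ∀ n, z • w n = jacobiAction A B w n) (h0 : v 0 = w 0) : v = w := by
  have key : ∀ n, v n = w n ∧ v (n + 1) = w (n + 1) := by
    intro n
    induction n with
    | zero =>
      refine ⟨h0, toLpLin_injective (hA 0) ?_⟩
      have h1 := hv 0
      have h2 := hw 0
      rw [jacobiAction, h0] at h1
      rw [jacobiAction] at h2
      exact add_right_cancel (h1.symm.trans h2)
    | succ n ih =>
      refine ⟨ih.2, toLpLin_injective (hA (n + 1)) ?_⟩
      have h1 := hv (n + 1)
      have h2 := hw (n + 1)
      rw [jacobiAction, ih.1, ih.2] at h1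
      rw [jacobiAction] at h2
      exact add_right_cancel (add_right_cancel (h1.symm.trans h2))
  exact funext fun n => (key n).1

end JacobiOperator

namespace MatrixMeasure

variable {N : ℕ} {μ : MatrixMeasure N} (hμ : μ.HasPosDefEvenMoments)
  {P : ℕ → Polynomial (Matrix (Fin N) (Fin N) ℂ)} (hP : μ.IsOrthonormalPolys P)

/-- The isometric embedding `v ↦ P_n^* v` of `ℂ^N` into `L²_v(μ)`. -/
def polyIsometry (n : ℕ) : EuclideanSpace ℂ (Fin N) →ₗᵢ[ℂ] μ.L2 :=
  LinearMap.isometryOfInner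
    { toFun := fun v => polyVec hμ (P n) v.ofLp
      map_add' := fun v w => polyVec_add_right hμ (P n) v.ofLp w.ofLp
      map_smul' := fun c v => polyVec_smul_right hμ (P n) c v.ofLp }
    fun v w => by
      change inner ℂ (polyVec hμ (P n) v.ofLp) (polyVec hμ (P n) w.ofLp) = _
      rw [inner_polyVec, pairing_orthonormal hP, if_pos rfl, Matrix.one_mulVec,
        EuclideanSpace.inner_eq_star_dotProduct, dotProduct_comm]

theorem orthogonalFamily_polyIsometry :
    OrthogonalFamily ℂ (fun _ : ℕ => EuclideanSpace ℂ (Fin N)) (polyIsometry hμ hP) := by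
  intro n m hnm v w
  change inner ℂ (polyVec hμ (P n) v.ofLp) (polyVec hμ (P m) w.ofLp) = 0
  rw [inner_polyVec, pairing_orthonormal hP, if_neg hnm, Matrix.zero_mulVec, dotProduct_zero]

/-- The isometry `(v_n) ↦ ∑ P_n^* v_n` of `ℓ²(ℂ^N)` into `L²_v(μ)`. -/
def spectralIsometry : Ell2 N →ₗᵢ[ℂ] μ.L2 := (orthogonalFamily_polyIsometry hμ hP).linearIsometry

theorem hasSum_spectralIsometry (V : Ell2 N) :
    HasSum (fun n => polyVec hμ (P n) (V n).ofLp) (spectralIsometry hμ hP V) :=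
  (orthogonalFamily_polyIsometry hμ hP).hasSum_linearIsometry V

theorem polyVec_eq_spectralIsometry (n : ℕ) (v : EuclideanSpace ℂ (Fin N)) :
    polyVec hμ (P n) v.ofLp = spectralIsometry hμ hP (lp.single 2 n v) :=
  ((orthogonalFamily_polyIsometry hμ hP).linearIsometry_apply_single v).symm

include hμ hP

theorem polyVec_X_mul_zero (v : EuclideanSpace ℂ (Fin N)) :
    polyVec hμ (Polynomial.X * P 0) v.ofLp =
      polyVec hμ (P 1) ((μ.jacobiA P 0)ᴴ *ᵥ v.ofLp) +
        polyVec hμ (P 0) (μ.jacobiB P 0 *ᵥ v.ofLp) := by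
  rw [X_mul_zero hμ hP, polyVec_add_left, polyVec_C_mul, polyVec_C_mul,
    (isHermitian_jacobiB hμ 0).eq]

theorem polyVec_X_mul_succ (n : ℕ) (v : EuclideanSpace ℂ (Fin N)) :
    polyVec hμ (Polynomial.X * P (n + 1)) v.ofLp =
      polyVec hμ (P (n + 2)) ((μ.jacobiA P (n + 1))ᴴ *ᵥ v.ofLp) +
        polyVec hμ (P (n + 1)) (μ.jacobiB P (n + 1) *ᵥ v.ofLp) +
        polyVec hμ (P n) (μ.jacobiA P n *ᵥ v.ofLp) := by
  rw [X_mul_succ hμ hP, polyVec_add_left, polyVec_add_left, polyVec_C_mul, polyVec_C_mul,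
    polyVec_C_mul, (isHermitian_jacobiB hμ (n + 1)).eq, Matrix.conjTranspose_conjTranspose]

/-- Summation by parts for `∑ x P_n^* v_n`, with its boundary terms. -/
theorem sum_polyVec_X_mul (v : ℕ → EuclideanSpace ℂ (Fin N)) (m : ℕ) :
    ∑ n ∈ Finset.range (m + 1), polyVec hμ (Polynomial.X * P n) (v n).ofLp =
      ∑ n ∈ Finset.range (m + 1),
        polyVec hμ (P n) (jacobiAction (μ.jacobiA P) (μ.jacobiB P) v n).ofLp +
      polyVec hμ (P (m + 1)) ((μ.jacobiA P m)ᴴ *ᵥ (v m).ofLp) -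
      polyVec hμ (P m) (μ.jacobiA P m *ᵥ (v (m + 1)).ofLp) := by
  induction m with
  | zero =>
    simp only [zero_add, Finset.range_one, Finset.sum_singleton, jacobiAction, WithLp.ofLp_add,
      polyVec_add_right, polyVec_X_mul_zero hμ hP, Matrix.ofLp_toLpLin, Matrix.toLin'_apply]
    abel
  | succ m ih =>
    rw [Finset.sum_range_succ, ih, Finset.sum_range_succ _ (m + 1)]
    simp only [jacobiAction, WithLp.ofLp_add, polyVec_add_right, polyVec_X_mul_succ hμ hP,
      Matrix.ofLp_toLpLin, Matrix.toLin'_apply]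
    abel

omit hP in
theorem polyVec_zero_right (Q : Polynomial (Matrix (Fin N) (Fin N) ℂ)) :
    polyVec hμ Q 0 = 0 := by
  have := polyVec_smul_right hμ Q 0 0
  rwa [zero_smul, zero_smul] at this

/-- The Jacobi operator is carried into multiplication by the variable. -/
theorem spectralIsometry_mem_mulGraph {p : Ell2 N × Ell2 N}
    (hp : p ∈ (jacobiOp (μ.jacobiA P) (μ.jacobiB P)).graph) :
    (spectralIsometry hμ hP p.1, spectralIsometry hμ hP p.2) ∈ μ.mulGraph := by
  obtain ⟨V, h1, h2⟩ := (LinearPMap.mem_graph_iff _).1 hp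
  obtain ⟨m, hm⟩ := exists_forall_lt_eq_zero V.2
  have e1 : spectralIsometry hμ hP p.1 =
      ∑ n ∈ Finset.range (m + 2), polyVec hμ (P n) ((V : Ell2 N) n).ofLp := by
    rw [← h1]
    refine (hasSum_spectralIsometry hμ hP _).unique (hasSum_sum_of_ne_finset_zero fun n hn => ?_)
    rw [hm n (by rw [Finset.mem_range] at hn; omega)]
    exact polyVec_zero_right hμ _
  have e2 : spectralIsometry hμ hP p.2 = ∑ n ∈ Finset.range (m + 2),
      polyVec hμ (P n) (jacobiAction (μ.jacobiA P) (μ.jacobiB P) (V : Ell2 N) n).ofLp := by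
    rw [← h2]
    refine (hasSum_spectralIsometry hμ hP _).unique (hasSum_sum_of_ne_finset_zero fun n hn => ?_)
    change polyVec hμ (P n) (jacobiAction (μ.jacobiA P) (μ.jacobiB P) (V : Ell2 N) n).ofLp = 0
    rw [jacobiAction_eq_zero hm (by rw [Finset.mem_range] at hn; omega)]
    exact polyVec_zero_right hμ _
  -- the sums run up to `m + 1`, the last index at which `J V` may be nonzero
  have e3 := sum_polyVec_X_mul hμ hP (fun n => (V : Ell2 N) n) (m + 1)
  rw [hm (m + 1) (by omega), hm (m + 1 + 1) (by omega), WithLp.ofLp_zero, Matrix.mulVec_zero,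
    Matrix.mulVec_zero, polyVec_zero_right hμ, polyVec_zero_right hμ, add_zero,
    sub_zero] at e3
  rw [e1, e2, ← e3]
  have h4 := μ.mulGraph.sum_mem (t := Finset.range (m + 2)) fun n _ =>
    polyVec_X_mul_mem hμ (P n) ((V : Ell2 N) n).ofLp
  convert h4 using 1
  refine Prod.ext ?_ ?_
  · rw [Prod.fst_sum]
  · rw [Prod.snd_sum]

/-- The Jacobi operator is symmetric, since multiplication by the variable is. -/
theorem isFormalAdjoint_jacobiOp :
    (jacobiOp (μ.jacobiA P) (μ.jacobiB P)).IsFormalAdjoint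
      (jacobiOp (μ.jacobiA P) (μ.jacobiB P)) := by
  intro V W
  rw [← (spectralIsometry hμ hP).inner_map_map,
    ← (spectralIsometry hμ hP).inner_map_map (V : Ell2 N)]
  exact μ.mulGraph_symm (spectralIsometry_mem_mulGraph hμ hP (LinearPMap.mem_graph _ V))
    (spectralIsometry_mem_mulGraph hμ hP (LinearPMap.mem_graph _ W))

omit hμ hP in
theorem toLpLin_mul_apply (M M' : Matrix (Fin N) (Fin N) ℂ) (w : EuclideanSpace ℂ (Fin N)) :
    Matrix.toLpLin 2 2 (M * M') w = Matrix.toLpLin 2 2 M (Matrix.toLpLin 2 2 M' w) := by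
  apply WithLp.ofLp_injective 2
  simp only [Matrix.ofLp_toLpLin, Matrix.toLin'_apply, Matrix.mulVec_mulVec]

/-- The columns of the orthonormal polynomials solve the three-term recurrence. -/
theorem smul_evalAt_eq_jacobiAction (z : ℂ) (w : EuclideanSpace ℂ (Fin N)) (n : ℕ) :
    z • Matrix.toLpLin 2 2 (evalAt (P n) z) w = jacobiAction (μ.jacobiA P) (μ.jacobiB P)
      (fun n => Matrix.toLpLin 2 2 (evalAt (P n) z) w) n := by
  rw [← LinearMap.smul_apply, ← map_smul]
  cases n with
  | zero =>
    rw [recurrence_zero hμ hP, jacobiAction, map_add, LinearMap.add_apply, toLpLin_mul_apply,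
      toLpLin_mul_apply]
  | succ n =>
    rw [recurrence_succ hμ hP, jacobiAction, map_add, map_add, LinearMap.add_apply,
      LinearMap.add_apply, toLpLin_mul_apply, toLpLin_mul_apply, toLpLin_mul_apply]

omit hμ in
theorem eq_C_coeff_zero : P 0 = Polynomial.C ((P 0).coeff 0) :=
  Polynomial.eq_C_of_natDegree_le_zero (hP.natDegree_le 0)

omit hμ in
theorem evalAt_zero (z : ℂ) : evalAt (P 0) z = (P 0).coeff 0 := by
  rw [eq_C_coeff_zero hP, evalAt, Polynomial.eval_C, Polynomial.coeff_C_zero]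

/-- An eigenvector of the adjoint has the entries `P_n(z) w`. -/
theorem exists_of_mem_adjoint_graph {z : ℂ} {V : Ell2 N}
    (hV : (V, z • V) ∈ (jacobiOp (μ.jacobiA P) (μ.jacobiB P)).adjoint.graph) :
    ∃ w : EuclideanSpace ℂ (Fin N), (V : ℕ → EuclideanSpace ℂ (Fin N)) =
      fun n => Matrix.toLpLin 2 2 (evalAt (P n) z) w := by
  obtain ⟨b, hb⟩ := (hP.isUnit_coeff 0).exists_right_inv
  refine ⟨Matrix.toLpLin 2 2 b (V 0), eq_of_jacobiAction_eq (z := z) (det_jacobiA_ne_zero hμ hP)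
    (fun n => jacobiAction_eq_of_mem_adjoint (isHermitian_jacobiB hμ) hV n)
    (smul_evalAt_eq_jacobiAction hμ hP z _) ?_⟩
  rw [evalAt_zero hP, ← toLpLin_mul_apply, hb, Matrix.toLpLin_one]
  rfl

/-- Without square summable solutions `(P_n(z) v)` at non-real `z`, the deficiency spaces of the
Jacobi operator vanish. -/
theorem isEssentiallySelfAdjoint_of_forall_notMem
    (h : ∀ z : ℂ, z.im ≠ 0 → ∀ v : EuclideanSpace ℂ (Fin N), v ≠ 0 →
      (fun n => Matrix.toLpLin 2 2 (evalAt (P n) z) v) ∉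
        freeSolutions (μ.jacobiA P) (μ.jacobiB P) z) :
    IsEssentiallySelfAdjoint (jacobiOp (μ.jacobiA P) (μ.jacobiB P)) := by
  have key : ∀ z : ℂ, z.im ≠ 0 → ∀ V : Ell2 N,
      (V, z • V) ∈ (jacobiOp (μ.jacobiA P) (μ.jacobiB P)).adjoint.graph → V = 0 := by
    intro z hz V hV
    obtain ⟨w, hw⟩ := exists_of_mem_adjoint_graph hμ hP hV
    by_cases hw0 : w = 0
    · refine lp.ext (hw.trans (funext fun n => ?_))
      rw [hw0, map_zero]
      rfl
    · refine absurd ⟨?_, 0, fun n _ => smul_evalAt_eq_jacobiAction hμ hP z w n⟩ (h z hz w hw0)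
      rw [← hw]
      exact V.2
  refine LinearPMap.isEssentiallySelfAdjoint_of_adjoint (dense_finiteSequences N)
    (isFormalAdjoint_jacobiOp hμ hP) (key _ (by simp)) (key _ (by simp))

end MatrixMeasure

end

/-! ### Density of the polynomials and the spectrum -/

noncomputable section

open scoped BoundedContinuousFunction

section Determination

variable {ν : Measure ℝ} [IsFiniteMeasure ν]

/-- A real integrable function is determined by its integrals against a separating algebra of
bounded continuous functions: the measures with densities `h⁺` and `h⁻` agree. -/
theorem ae_eq_zero_of_forall_integral_mul_ofReal {A : StarSubalgebra ℂ (ℝ →ᵇ ℂ)}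
    (hA : (A.map (BoundedContinuousFunction.toContinuousMapStarₐ ℂ)).SeparatesPoints) {h : ℝ → ℝ}
    (hm : Measurable h) (hi : Integrable h ν) (h0 : ∀ a ∈ A, ∫ x, a x * (h x : ℂ) ∂ν = 0) :
    h =ᵐ[ν] 0 := by
  have hfin : ∀ g : ℝ → ℝ, Integrable g ν →
      IsFiniteMeasure (ν.withDensity fun x => ((g x).toNNReal : ENNReal)) := fun g hg =>
    isFiniteMeasure_withDensity_ofReal hg.2
  have hpm : Measurable fun x => (h x).toNNReal := hm.real_toNNReal
  have hnm : Measurable fun x => (-h x).toNNReal := hm.neg.real_toNNReal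
  have hfp := hfin h hi
  have hfn := hfin (fun x => -h x) hi.neg
  have key : (ν.withDensity fun x => ((h x).toNNReal : ENNReal)) =
      ν.withDensity fun x => ((-h x).toNNReal : ENNReal) := by
    refine ext_of_forall_mem_subalgebra_integral_eq_of_polish (𝕜 := ℂ) hA fun a ha => ?_
    have hint : ∀ g : ℝ → ℝ, Integrable g ν →
        Integrable (fun x => (g x).toNNReal • a x) ν := by
      intro g hg
      have h1 : Integrable (fun x => (((g x).toNNReal : ℝ) : ℂ)) ν := by
        refine Integrable.ofReal ?_
        exact hg.pos_part
      have h2 := h1.mul_bdd (c := ‖a‖) a.continuous.aestronglyMeasurable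
        (Filter.Eventually.of_forall a.norm_coe_le_norm)
      exact h2
    rw [integral_withDensity_eq_integral_smul hpm,
      integral_withDensity_eq_integral_smul hnm, ← sub_eq_zero,
      ← integral_sub (hint h hi) (hint (fun x => -h x) hi.neg), ← h0 a ha]
    refine integral_congr_ae (Filter.Eventually.of_forall fun x => ?_)
    have hx : (((h x).toNNReal : ℝ) : ℂ) - (((-h x).toNNReal : ℝ) : ℂ) = (h x : ℂ) := by
      rw [← Complex.ofReal_sub, Real.coe_toNNReal', Real.coe_toNNReal', max_zero_sub_eq_self]
    change (((h x).toNNReal : ℝ) : ℂ) * a x - (((-h x).toNNReal : ℝ) : ℂ) * a x = a x * (h x : ℂ)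
    rw [← sub_mul, hx, mul_comm]
  rw [withDensity_eq_iff_of_sigmaFinite hpm.coe_nnreal_ennreal.aemeasurable
    hnm.coe_nnreal_ennreal.aemeasurable] at key
  filter_upwards [key] with x hx
  have hx' : (h x).toNNReal = (-h x).toNNReal := by exact_mod_cast hx
  have h1 := max_zero_sub_eq_self (h x)
  rw [← Real.coe_toNNReal', ← Real.coe_toNNReal', hx', sub_self] at h1
  exact h1.symm

/-- The complex case follows for real and imaginary part separately, since the algebra is closed
under conjugation. -/
theorem ae_eq_zero_of_forall_integral_mul {A : StarSubalgebra ℂ (ℝ →ᵇ ℂ)}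
    (hA : (A.map (BoundedContinuousFunction.toContinuousMapStarₐ ℂ)).SeparatesPoints) {g : ℝ → ℂ}
    (hm : Measurable g) (hi : Integrable g ν) (h0 : ∀ a ∈ A, ∫ x, a x * g x ∂ν = 0) :
    g =ᵐ[ν] 0 := by
  have hint : ∀ (a : ℝ →ᵇ ℂ) {g : ℝ → ℂ}, Integrable g ν → Integrable (fun x => a x * g x) ν :=
    fun a g hg => hg.bdd_mul (c := ‖a‖) a.continuous.aestronglyMeasurable
      (Filter.Eventually.of_forall a.norm_coe_le_norm)
  have hconj : Integrable (fun x => star (g x)) ν :=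
    (Complex.conjCLE : ℂ →L[ℝ] ℂ).integrable_comp hi
  have h0' : ∀ a ∈ A, ∫ x, a x * star (g x) ∂ν = 0 := by
    intro a ha
    have h1 := congrArg star (h0 (star a) (star_mem ha))
    rw [star_zero] at h1
    rw [← h1, Complex.star_def, ← integral_conj]
    refine integral_congr_ae (Filter.Eventually.of_forall fun x => ?_)
    simp [mul_comm]
  have hre := ae_eq_zero_of_forall_integral_mul_ofReal hA (Complex.measurable_re.comp hm) hi.re
    fun a ha => by
      have h1 : ∀ x, a x * (((g x).re : ℝ) : ℂ) = 2⁻¹ * (a x * g x + a x * star (g x)) := by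
        intro x
        have := Complex.add_conj (g x)
        rw [← mul_add, Complex.star_def, this]
        push_cast
        ring
      change ∫ x, a x * (((g x).re : ℝ) : ℂ) ∂ν = 0
      simp only [h1]
      rw [integral_const_mul, integral_add (hint a hi) (hint a hconj), h0 a ha, h0' a ha, add_zero,
        mul_zero]
  have him := ae_eq_zero_of_forall_integral_mul_ofReal hA (Complex.measurable_im.comp hm) hi.im
    fun a ha => by
      have h1 : ∀ x, a x * (((g x).im : ℝ) : ℂ) =
          (2 * Complex.I)⁻¹ * (a x * g x - a x * star (g x)) := by
        intro x
        have := Complex.sub_conj (g x)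
        rw [← mul_sub, Complex.star_def, this]
        push_cast
        field_simp
      change ∫ x, a x * (((g x).im : ℝ) : ℂ) ∂ν = 0
      simp only [h1]
      rw [integral_const_mul, integral_sub (hint a hi) (hint a hconj), h0 a ha, h0' a ha, sub_zero,
        mul_zero]
  filter_upwards [hre, him] with x h1 h2
  exact Complex.ext h1 h2

end Determination

namespace MatrixMeasure

variable {N : ℕ} (μ : MatrixMeasure N)

/-- Multiplication by a bounded continuous function on `L²_v(μ)`. -/
def bcfMul (a : ℝ →ᵇ ℂ) : μ.L2 →L[ℂ] μ.L2 :=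
  μ.bddMul a a.continuous.measurable ‖a‖ a.norm_coe_le_norm

/-- The resolvent function `x ↦ (x - z)⁻¹` for a non-real `z`. -/
def resolventBCF (z : ℂ) (hz : z.im ≠ 0) : ℝ →ᵇ ℂ :=
  BoundedContinuousFunction.ofNormedAddCommGroup (fun x : ℝ => ((x : ℂ) - z)⁻¹)
    ((Complex.continuous_ofReal.sub continuous_const).inv₀ fun x h => hz (by
      have := congrArg Complex.im h
      simpa using this))
    |z.im|⁻¹ fun x => by
      rw [norm_inv]
      exact inv_anti₀ (abs_pos.2 hz) (not_lt.1 (not_norm_sub_lt_abs_im x))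

theorem bcfMul_resolventBCF {z : ℂ} (hz : z.im ≠ 0) (h : μ.L2) :
    μ.bcfMul (resolventBCF z hz) h = μ.resolvent z |z.im| (abs_pos.2 hz) h := by
  obtain ⟨f, rfl⟩ := SeparationQuotient.surjective_mk h
  obtain ⟨r, hr, hrf⟩ := μ.exists_bddMul_mk (resolventBCF z hz) _ _
    (resolventBCF z hz).norm_coe_le_norm f
  obtain ⟨s, hs, hsf⟩ := μ.exists_bddMul_mk (truncResolvent z |z.im|)
    (measurable_truncResolvent z _) _ (norm_truncResolvent_le z (abs_pos.2 hz)) f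
  refine hrf.trans (Eq.trans ?_ hsf.symm)
  refine μ.mk_eq_mk_of_ae (Filter.Eventually.of_forall fun x => ?_)
  rw [hr, hs]
  simp only
  rw [truncResolvent, if_neg (not_norm_sub_lt_abs_im x)]
  rfl

theorem star_resolventBCF {z : ℂ} (hz : z.im ≠ 0) :
    star (resolventBCF z hz) = resolventBCF (star z) (by simpa using hz) := by
  ext x
  change star (((x : ℂ) - z)⁻¹) = ((x : ℂ) - star z)⁻¹
  rw [star_inv₀, star_sub]
  simp

/-- The bounded continuous functions such that multiplication by them and by their conjugates leaves
a subspace of `L²_v(μ)` invariant. -/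
def invariantSubalgebra (K : Submodule ℂ μ.L2) : StarSubalgebra ℂ (ℝ →ᵇ ℂ) where
  carrier := {a | ∀ h ∈ K, μ.bcfMul a h ∈ K ∧ μ.bcfMul (star a) h ∈ K}
  mul_mem' := by
    have hmul : ∀ (a b : ℝ →ᵇ ℂ) (h : μ.L2), μ.bcfMul (a * b) h = μ.bcfMul a (μ.bcfMul b h) := by
      intro a b h
      obtain ⟨f, rfl⟩ := SeparationQuotient.surjective_mk h
      exact congrArg SeparationQuotient.mk
        (Subtype.ext (funext fun x => mul_smul (a x) (b x) (f.fn x)))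
    intro a b ha hb h hh
    refine ⟨hmul a b h ▸ (ha _ (hb h hh).1).1, ?_⟩
    rw [star_mul, hmul]
    exact (hb _ (ha h hh).2).2
  add_mem' := by
    have hadd : ∀ (a b : ℝ →ᵇ ℂ) (h : μ.L2), μ.bcfMul (a + b) h = μ.bcfMul a h + μ.bcfMul b h := by
      intro a b h
      obtain ⟨f, rfl⟩ := SeparationQuotient.surjective_mk h
      exact congrArg SeparationQuotient.mk
        (Subtype.ext (funext fun x => add_smul (a x) (b x) (f.fn x)))
    intro a b ha hb h hh
    refine ⟨hadd a b h ▸ K.add_mem (ha h hh).1 (hb h hh).1, ?_⟩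
    rw [star_add, hadd]
    exact K.add_mem (ha h hh).2 (hb h hh).2
  algebraMap_mem' := by
    have hc : ∀ (c : ℂ) (h : μ.L2), μ.bcfMul (algebraMap ℂ _ c) h = c • h := by
      intro c h
      obtain ⟨f, rfl⟩ := SeparationQuotient.surjective_mk h
      rw [← SeparationQuotient.mk_smul]
      refine congrArg SeparationQuotient.mk (Subtype.ext (funext fun x => ?_))
      change (algebraMap ℂ (ℝ →ᵇ ℂ) c) x • f.fn x = c • f.fn x
      rw [BoundedContinuousFunction.algebraMap_apply, smul_eq_mul, mul_one]
    intro c h hh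
    refine ⟨hc c h ▸ K.smul_mem c hh, ?_⟩
    rw [← algebraMap_star_comm, hc]
    exact K.smul_mem _ hh
  star_mem' := by
    intro a ha h hh
    refine ⟨(ha h hh).2, ?_⟩
    rw [star_star]
    exact (ha h hh).1

/-- A complete subspace containing the constants and invariant under the resolvents of
multiplication by the variable is the whole space. -/
theorem eq_top_of_resolvent_invariant {K : Submodule ℂ μ.L2} (hK : IsComplete (K : Set μ.L2))
    (hconst : ∀ j, ∃ h ∈ K, ∃ f : μ.PreL2, f.fn = (fun _ => Pi.single j 1) ∧
      SeparationQuotient.mk f = h)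
    (hres : ∀ (z : ℂ) (hz : z.im ≠ 0), ∀ h ∈ K, μ.resolvent z |z.im| (abs_pos.2 hz) h ∈ K) :
    K = ⊤ := by
  have hI : Complex.I.im ≠ 0 := by simp
  have hmem : resolventBCF Complex.I hI ∈ μ.invariantSubalgebra K := by
    intro h hh
    have hI' : (star Complex.I).im ≠ 0 := by simp
    rw [star_resolventBCF, bcfMul_resolventBCF, bcfMul_resolventBCF]
    exact ⟨hres _ hI h hh, hres _ hI' h hh⟩
  have hsep : ((μ.invariantSubalgebra K).map
      (BoundedContinuousFunction.toContinuousMapStarₐ ℂ)).SeparatesPoints := by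
    intro x y hxy
    refine ⟨resolventBCF Complex.I hI, ⟨_, ⟨_, hmem, rfl⟩, rfl⟩, fun h => hxy ?_⟩
    have h1 : ((x : ℂ) - Complex.I)⁻¹ = ((y : ℂ) - Complex.I)⁻¹ := h
    exact_mod_cast sub_left_injective (inv_injective h1)
  have : CompleteSpace K := hK.completeSpace_coe
  rw [← Submodule.orthogonal_eq_bot_iff, Submodule.eq_bot_iff]
  intro h hh
  obtain ⟨f, rfl⟩ := SeparationQuotient.surjective_mk h
  have hj : ∀ j, ∀ᵐ x ∂μ.trace,
      star (f.fn x) ⬝ᵥ (μ.density x *ᵥ (Pi.single j 1 : Fin N → ℂ)) = 0 := by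
    intro j
    obtain ⟨_, hkK, k, hk, rfl⟩ := hconst j
    refine ae_eq_zero_of_forall_integral_mul hsep (μ.measurable_form f.mem.1 measurable_const) ?_
      fun a ha => ?_
    · have := f.mem.integrable_form k.mem
      rwa [hk] at this
    · have h1 := (Submodule.mem_orthogonal' K _).1 hh _ (ha _ hkK).1
      rw [← h1]
      refine integral_congr_ae (Filter.Eventually.of_forall fun x => ?_)
      change _ = star (f.fn x) ⬝ᵥ (μ.density x *ᵥ (a x • k.fn x))
      rw [hk, Matrix.mulVec_smul, dotProduct_smul, smul_eq_mul]
  -- `f` is orthogonal to `a e_j` for all `a` in the algebra, hence `f^* W e_j = 0`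
  rw [PreL2.mk_eq_zero_iff]
  filter_upwards [ae_all_iff.2 hj] with x hx
  have h2 : star (f.fn x) ᵥ* μ.density x = 0 := by
    funext j
    have := hx j
    rwa [Matrix.dotProduct_mulVec, dotProduct_single_one] at this
  rw [Matrix.dotProduct_mulVec, h2, zero_dotProduct]

section Jacobi

variable {μ} (hμ : μ.HasPosDefEvenMoments)
  {P : ℕ → Polynomial (Matrix (Fin N) (Fin N) ℂ)} (hP : μ.IsOrthonormalPolys P)

/-- If the Jacobi operator is essentially self-adjoint, then the orthonormal polynomials span a
dense subspace: the range of the isometry is invariant under the resolvents since `J - z` has dense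
range. -/
theorem range_spectralIsometry_eq_top
    (h : IsEssentiallySelfAdjoint (jacobiOp (μ.jacobiA P) (μ.jacobiB P))) :
    LinearMap.range (spectralIsometry hμ hP).toLinearMap = ⊤ := by
  have hcomplete : IsComplete (LinearMap.range (spectralIsometry hμ hP).toLinearMap : Set μ.L2) :=
    (spectralIsometry hμ hP).isometry.isUniformInducing.isComplete_range
  refine μ.eq_top_of_resolvent_invariant hcomplete (fun j => ?_) ?_
  · obtain ⟨b, hb⟩ := (hP.isUnit_coeff 0).exists_left_inv
    refine ⟨polyVec hμ (P 0) (bᴴ *ᵥ Pi.single j 1),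
      ⟨_, (polyVec_eq_spectralIsometry hμ hP 0 (WithLp.toLp 2 (bᴴ *ᵥ Pi.single j 1))).symm⟩,
      _, ?_, rfl⟩
    funext x
    rw [MemL2.fn_toPre, evalAt_zero hP, Matrix.mulVec_mulVec, ← Matrix.conjTranspose_mul, hb,
      Matrix.conjTranspose_one, Matrix.one_mulVec]
  · rintro z hz _ ⟨Y, rfl⟩
    set R := μ.resolvent z |z.im| (abs_pos.2 hz)
    have hclosed : IsClosed {Y : Ell2 N | R (spectralIsometry hμ hP Y) ∈
        (LinearMap.range (spectralIsometry hμ hP).toLinearMap : Set μ.L2)} :=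
      hcomplete.isClosed.preimage (R.continuous.comp (spectralIsometry hμ hP).continuous)
    have hdense := LinearPMap.dense_range_sub_of_isEssentiallySelfAdjoint h hz
    refine hclosed.closure_subset_iff.2 ?_ (hdense Y)
    rintro _ ⟨V, rfl⟩
    refine ⟨V, ?_⟩
    have h1 := spectralIsometry_mem_mulGraph hμ hP (LinearPMap.mem_graph _ V)
    have h2 := μ.resolvent_of_mem_mulGraph (abs_pos.2 hz)
      (Filter.Eventually.of_forall fun x => not_norm_sub_lt_abs_im x) h1
    change spectralIsometry hμ hP V = R (spectralIsometry hμ hP (_ - z • (V : Ell2 N)))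
    rw [map_sub, map_smul]
    exact h2.symm

/-- The unitary map `(v_n) ↦ ∑ P_n^* v_n`. -/
def spectralUnitary (h : IsEssentiallySelfAdjoint (jacobiOp (μ.jacobiA P) (μ.jacobiB P))) :
    Ell2 N ≃ₗᵢ[ℂ] μ.L2 :=
  LinearIsometryEquiv.ofSurjective (spectralIsometry hμ hP)
    (LinearMap.range_eq_top.1 (range_spectralIsometry_eq_top hμ hP h))

/-- The adjoint of the Jacobi operator is unitarily equivalent to multiplication by the variable:
it is the closure, and the graph of the multiplication is closed and symmetric. -/
theorem mem_adjoint_graph_iff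
    (h : IsEssentiallySelfAdjoint (jacobiOp (μ.jacobiA P) (μ.jacobiB P))) (x y : Ell2 N) :
    (x, y) ∈ (jacobiOp (μ.jacobiA P) (μ.jacobiB P)).adjoint.graph ↔
      (spectralIsometry hμ hP x, spectralIsometry hμ hP y) ∈ μ.mulGraph := by
  constructor
  · intro hxy
    rw [← (LinearPMap.adjoint_of_isEssentiallySelfAdjoint h).2,
      ← h.2.1.graph_closure_eq_closure_graph] at hxy
    have hxy' : (x, y) ∈ closure
        ((jacobiOp (μ.jacobiA P) (μ.jacobiB P)).graph : Set (Ell2 N × Ell2 N)) := hxy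
    have hcont : Continuous fun p : Ell2 N × Ell2 N =>
        (spectralIsometry hμ hP p.1, spectralIsometry hμ hP p.2) :=
      ((spectralIsometry hμ hP).continuous.comp continuous_fst).prodMk
        ((spectralIsometry hμ hP).continuous.comp continuous_snd)
    have hmaps : Set.MapsTo (fun p : Ell2 N × Ell2 N =>
        (spectralIsometry hμ hP p.1, spectralIsometry hμ hP p.2))
        (jacobiOp (μ.jacobiA P) (μ.jacobiB P)).graph μ.mulGraph :=
      fun p hp => spectralIsometry_mem_mulGraph hμ hP hp
    have hcl := map_mem_closure hcont hxy' hmaps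
    rw [μ.isClosed_mulGraph.closure_eq] at hcl
    exact hcl
  · intro hxy
    rw [LinearPMap.mem_graph_adjoint_iff h.1]
    intro V
    change inner ℂ (jacobiOp (μ.jacobiA P) (μ.jacobiB P) V) x = inner ℂ (V : Ell2 N) y
    rw [← (spectralIsometry hμ hP).inner_map_map,
      ← (spectralIsometry hμ hP).inner_map_map (V : Ell2 N)]
    exact μ.mulGraph_symm (spectralIsometry_mem_mulGraph hμ hP (LinearPMap.mem_graph _ V)) hxy

end Jacobi

end MatrixMeasure

section Spectrum

variable {H K : Type} [NormedAddCommGroup H] [InnerProductSpace ℂ H]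
  [NormedAddCommGroup K] [InnerProductSpace ℂ K]

/-- The resolvent set, in terms of the graph of the operator. -/
theorem notMem_unboundedSpectrum_iff {T : H →ₗ.[ℂ] H} {z : ℂ} : z ∉ unboundedSpectrum T ↔
    ∃ R : H →L[ℂ] H, (∀ h, (R h, h + z • R h) ∈ T.graph) ∧
      ∀ p ∈ T.graph, R (p.2 - z • p.1) = p.1 := by
  rw [unboundedSpectrum, Set.mem_ofPred_eq, not_not]
  refine exists_congr fun R => and_congr_right fun _ => ⟨fun h p hp => ?_, fun h x => ?_⟩
  · obtain ⟨x, h1, h2⟩ := (LinearPMap.mem_graph_iff T).1 hp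
    rw [← h1, ← h2]
    exact h x
  · exact h _ (T.mem_graph x)

theorem Intertwines.notMem_unboundedSpectrum {U : H ≃ₗᵢ[ℂ] K} {T : H →ₗ.[ℂ] H} {S : K →ₗ.[ℂ] K}
    (h : Intertwines U T S) {z : ℂ} (hz : z ∉ unboundedSpectrum S) : z ∉ unboundedSpectrum T := by
  rw [notMem_unboundedSpectrum_iff] at hz ⊢
  obtain ⟨R, h1, h2⟩ := hz
  refine ⟨(U.symm.toContinuousLinearEquiv : K →L[ℂ] H) ∘L R ∘L
    (U.toContinuousLinearEquiv : H →L[ℂ] K), fun x => ?_, fun p hp => ?_⟩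
  · refine (h _ _).2 ?_
    change (U (U.symm (R (U x))), U (x + z • U.symm (R (U x)))) ∈ S.graph
    rw [map_add, map_smul, U.apply_symm_apply]
    exact h1 (U x)
  · change U.symm (R (U (p.2 - z • p.1))) = p.1
    rw [map_sub, map_smul, h2 (U p.1, U p.2) ((h p.1 p.2).1 hp), U.symm_apply_apply]

theorem Intertwines.symm {U : H ≃ₗᵢ[ℂ] K} {T : H →ₗ.[ℂ] H} {S : K →ₗ.[ℂ] K}
    (h : Intertwines U T S) : Intertwines U.symm S T := fun x y => by
  rw [h, U.apply_symm_apply, U.apply_symm_apply]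

theorem Intertwines.unboundedSpectrum_eq {U : H ≃ₗᵢ[ℂ] K} {T : H →ₗ.[ℂ] H} {S : K →ₗ.[ℂ] K}
    (h : Intertwines U T S) : unboundedSpectrum T = unboundedSpectrum S :=
  Set.ext fun _ => not_iff_not.1 ⟨h.symm.notMem_unboundedSpectrum, h.notMem_unboundedSpectrum⟩

end Spectrum

namespace MatrixMeasure

variable {N : ℕ} (μ : MatrixMeasure N)

/-- A set of positive trace measure carries a constant vector field of positive length. -/
theorem exists_mk_indicator_ne_zero {B : Set ℝ} (hB : MeasurableSet B) (h0 : μ.trace B ≠ 0) :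
    ∃ f : μ.PreL2, (∀ x ∉ B, f.fn x = 0) ∧ (SeparationQuotient.mk f : μ.L2) ≠ 0 := by
  by_contra! hcon
  have hdiag : ∀ j, μ.toVectorMeasure B j j = 0 := by
    intro j
    have hconst : μ.MemL2 fun _ => Pi.single j 1 := by
      refine ⟨measurable_const, ?_⟩
      simpa only [star_single_dotProduct_mulVec_single] using μ.integrable_density j j
    classical
    have hmem : μ.MemL2 (B.indicator fun _ => Pi.single j 1) := by
      have h1 := hconst.bdd_smul (φ := B.indicator fun _ => 1) (measurable_const.indicator hB)
        (C := 1) fun x => by by_cases hx : x ∈ B <;> simp [hx]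
      refine h1.congr_ae (measurable_const.indicator hB) (Filter.Eventually.of_forall fun x => ?_)
      by_cases hx : x ∈ B <;> simp [hx]
    have h2 := hcon hmem.toPre fun x hx => by
      rw [MemL2.fn_toPre, Set.indicator_of_notMem hx]
    rw [PreL2.mk_eq_zero_iff] at h2
    rw [μ.apply_eq_setIntegral_density hB]
    refine setIntegral_eq_zero_of_ae_eq_zero ?_
    filter_upwards [h2] with x hx hxB
    rwa [MemL2.fn_toPre, Set.indicator_of_mem hxB, star_single_dotProduct_mulVec_single] at hx
  have h1 := μ.trace_real_apply hB
  rw [Matrix.trace, Finset.sum_eq_zero fun j _ => (Matrix.diag_apply _ j).trans (hdiag j),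
    Complex.zero_re, measureReal_eq_zero_iff] at h1
  exact h0 h1

theorem notMem_unboundedSpectrum_mulOp {z : ℂ} (hz : z ∉ Complex.ofReal '' μ.trace.support) :
    z ∉ unboundedSpectrum μ.mulOp := by
  have hcl : IsClosed (Complex.ofReal '' μ.trace.support) :=
    Complex.isometry_ofReal.isClosedEmbedding.isClosedMap _ Measure.isClosed_support
  obtain ⟨δ, hδ, hball⟩ := Metric.isOpen_iff.1 hcl.isOpen_compl z hz
  have hae : ∀ᵐ x : ℝ ∂μ.trace, ¬ ‖(x : ℂ) - z‖ < δ := by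
    filter_upwards [Measure.support_mem_ae (μ := μ.trace)] with x hx hlt
    exact hball (mem_ball_iff_norm.2 hlt) ⟨x, hx, rfl⟩
  rw [notMem_unboundedSpectrum_iff, mulOp_graph]
  exact ⟨μ.resolvent z δ hδ, fun h => μ.resolvent_mem_mulGraph hδ hae h,
    fun p hp => μ.resolvent_of_mem_mulGraph hδ hae hp⟩

/-- Functions concentrated near a point `x₀` of the support are approximate eigenvectors. -/
theorem mem_unboundedSpectrum_mulOp {x₀ : ℝ} (hx₀ : x₀ ∈ μ.trace.support) :
    (x₀ : ℂ) ∈ unboundedSpectrum μ.mulOp := by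
  by_contra hcon
  rw [notMem_unboundedSpectrum_iff, mulOp_graph] at hcon
  obtain ⟨R, -, hR⟩ := hcon
  -- chosen so that `‖R‖ ε < 1`: an `f` concentrated on the `ε`-ball has `f = R ((x - x₀) f)`, so
  -- that `‖f‖ ≤ ‖R‖ ε ‖f‖`
  set ε : ℝ := (‖R‖ + 1)⁻¹ with hε
  have hε0 : 0 < ε := by positivity
  have hpos := (Measure.mem_support_iff_forall _).1 hx₀ _ (Metric.ball_mem_nhds x₀ hε0)
  obtain ⟨f, hf, hne⟩ := μ.exists_mk_indicator_ne_zero measurableSet_ball hpos.ne'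
  have hφm : Measurable ((Metric.ball x₀ ε).indicator fun x : ℝ => (x : ℂ) - x₀) :=
    (Complex.measurable_ofReal.sub_const _).indicator measurableSet_ball
  have hφ : ∀ x, ‖(Metric.ball x₀ ε).indicator (fun x : ℝ => (x : ℂ) - x₀) x‖ ≤ ε := by
    intro x
    by_cases hx : x ∈ Metric.ball x₀ ε
    · rw [Set.indicator_of_mem hx, ← Complex.ofReal_sub, Complex.norm_real]
      exact (mem_ball_iff_norm.1 hx).le
    · rw [Set.indicator_of_notMem hx, norm_zero]
      exact hε0.le
  have hmul := μ.norm_bddMul_le _ hφm ε hφ (SeparationQuotient.mk f)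
  obtain ⟨r, hr, hrf⟩ := μ.exists_bddMul_mk _ hφm ε hφ f
  rw [hrf] at hmul
  have hgraph : ((SeparationQuotient.mk f : μ.L2),
      (SeparationQuotient.mk (r + (x₀ : ℂ) • f) : μ.L2)) ∈ μ.mulGraph := by
    refine μ.mem_mulGraph.2 ⟨f, r + (x₀ : ℂ) • f, fun x => ?_, rfl, rfl⟩
    rw [PreL2.fn_add, PreL2.fn_smul, Pi.add_apply, Pi.smul_apply, hr]
    by_cases hx : x ∈ Metric.ball x₀ ε
    · simp only [Set.indicator_of_mem hx]
      rw [← add_smul, sub_add_cancel]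
    · simp only [hf x hx, smul_zero, add_zero]
  have h1 : R (SeparationQuotient.mk (r + (x₀ : ℂ) • f) - (x₀ : ℂ) • SeparationQuotient.mk f) =
      SeparationQuotient.mk f := hR _ hgraph
  rw [SeparationQuotient.mk_add, SeparationQuotient.mk_smul, add_sub_cancel_right] at h1
  have h2 : ‖(SeparationQuotient.mk f : μ.L2)‖ ≤
      ‖R‖ * (ε * ‖(SeparationQuotient.mk f : μ.L2)‖) := by
    conv_lhs => rw [← h1]
    exact (R.le_opNorm _).trans (mul_le_mul_of_nonneg_left hmul (norm_nonneg _))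
  have h3 : 0 < ‖(SeparationQuotient.mk f : μ.L2)‖ := norm_pos_iff.2 hne
  have h4 : ‖R‖ * ε < 1 := by
    rw [hε, ← div_eq_mul_inv, div_lt_one (by positivity)]
    exact lt_add_one _
  rw [← mul_assoc] at h2
  exact absurd h2 (not_le.2 (mul_lt_of_lt_one_left h3 h4))

theorem unboundedSpectrum_mulOp :
    unboundedSpectrum μ.mulOp = Complex.ofReal '' μ.trace.support := by
  refine Set.Subset.antisymm (fun z hz => ?_) ?_
  · by_contra hcon
    exact μ.notMem_unboundedSpectrum_mulOp hcon hz
  · rintro _ ⟨x, hx, rfl⟩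
    exact μ.mem_unboundedSpectrum_mulOp hx

end MatrixMeasure

end

/-! ### The spectral decomposition of the Jacobi operator -/

theorem corollary5p7 (N : ℕ) (μ : MatrixMeasure N) (hμ : μ.HasPosDefEvenMoments)
    (P : ℕ → Polynomial (Matrix (Fin N) (Fin N) ℂ)) (hP : μ.IsOrthonormalPolys P) :
    -- the three-term recurrence that defines the Jacobi operator
    ((∀ n, (μ.jacobiA P n).det ≠ 0 ∧ (μ.jacobiB P n).IsHermitian) ∧
      (∀ z : ℂ, z • MatrixMeasure.evalAt (P 0) z =
        μ.jacobiA P 0 * MatrixMeasure.evalAt (P 1) z +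
          μ.jacobiB P 0 * MatrixMeasure.evalAt (P 0) z) ∧
      (∀ (n : ℕ) (z : ℂ), z • MatrixMeasure.evalAt (P (n + 1)) z =
        μ.jacobiA P (n + 1) * MatrixMeasure.evalAt (P (n + 2)) z +
          μ.jacobiB P (n + 1) * MatrixMeasure.evalAt (P (n + 1)) z +
          (μ.jacobiA P n)ᴴ * MatrixMeasure.evalAt (P n) z)) ∧
    -- the condition on the polynomial solutions gives essential self-adjointness
    ((∀ z : ℂ, z.im ≠ 0 → ∀ v : EuclideanSpace ℂ (Fin N), v ≠ 0 →
        (fun n => Matrix.toLpLin 2 2 (MatrixMeasure.evalAt (P n) z) v) ∉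
          freeSolutions (μ.jacobiA P) (μ.jacobiB P) z) →
      IsEssentiallySelfAdjoint (jacobiOp (μ.jacobiA P) (μ.jacobiB P))) ∧
    -- the spectral decomposition of the adjoint, and its multiplicity
    (IsEssentiallySelfAdjoint (jacobiOp (μ.jacobiA P) (μ.jacobiB P)) →
      IsSelfAdjoint (jacobiOp (μ.jacobiA P) (μ.jacobiB P)).adjoint ∧
      (jacobiOp (μ.jacobiA P) (μ.jacobiB P)).closure =
        (jacobiOp (μ.jacobiA P) (μ.jacobiB P)).adjoint ∧
      (∃ U : Ell2 N ≃ₗᵢ[ℂ] μ.L2,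
        (∀ V : Ell2 N, HasSum
          (fun n => μ.toL2 (fun x => (MatrixMeasure.evalAt (P n) x)ᴴ *ᵥ (V n).ofLp)
            (hμ.memL2 (P n) (V n).ofLp)) (U V)) ∧
        Intertwines U (jacobiOp (μ.jacobiA P) (μ.jacobiB P)).adjoint μ.mulOp) ∧
      unboundedSpectrum (jacobiOp (μ.jacobiA P) (μ.jacobiB P)).adjoint =
        Complex.ofReal '' μ.trace.support ∧
      IsMultiplicityFunction (jacobiOp (μ.jacobiA P) (μ.jacobiB P)).adjoint μ.trace
        (fun x => (μ.density x).rank)) := by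
  refine ⟨⟨fun n => ⟨MatrixMeasure.det_jacobiA_ne_zero hμ hP n,
    MatrixMeasure.isHermitian_jacobiB hμ n⟩, MatrixMeasure.recurrence_zero hμ hP,
    MatrixMeasure.recurrence_succ hμ hP⟩,
    MatrixMeasure.isEssentiallySelfAdjoint_of_forall_notMem hμ hP, fun h => ?_⟩
  have hU : Intertwines (MatrixMeasure.spectralUnitary hμ hP h)
      (jacobiOp (μ.jacobiA P) (μ.jacobiB P)).adjoint μ.mulOp := fun x y => by
    rw [μ.mulOp_graph]
    exact MatrixMeasure.mem_adjoint_graph_iff hμ hP h x y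
  obtain ⟨hsa, hcl⟩ := LinearPMap.adjoint_of_isEssentiallySelfAdjoint h
  refine ⟨hsa, hcl, ⟨MatrixMeasure.spectralUnitary hμ hP h,
    fun V => MatrixMeasure.hasSum_spectralIsometry hμ hP V, hU⟩, ?_,
    MatrixMeasure.measurable_rank μ.measurable_density, μ.ae_rank_pos,
    (MatrixMeasure.spectralUnitary hμ hP h).trans μ.directIntegralEquiv, fun x y => ?_⟩
  · rw [hU.unboundedSpectrum_eq, μ.unboundedSpectrum_mulOp]
  · rw [hU x y, μ.mulOp_graph, directIntegralMulOp_graph]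
    exact μ.mem_mulGraph_iff_directIntegralEquiv _ _
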